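/- All manifolds are smooth, finite-dimensional, Hausdorff and second countable. Let $\mathcal{G}$ be a Lie groupoid over a manifold $M$, with source and target maps $s,t:\mathcal{G}\to M$ (the product $gh$ is defined when $s(g)=t(h)$), and let $x\in M$. The orbit of $y\in M$ is $\mathcal{O}_y=\{t(g): g\in\mathcal{G},\ s(g)=y\}$, an immersed submanifold of $M$. A slice at $x$ is an embedded submanifold $\Sigma\subset M$ containing $x$ such that $\Sigma$ is transversal to every orbit that it meets, $\dim\Sigma+\dim\mathcal{O}_x=\dim M$, and $\Sigma\cap\mathcal{O}_x=\{x\}$. For $B\subset M$ write $\mathcal{G}|_B=\{g\in\mathcal{G}: s(g),t(g)\in B\}$. A groupoid with arrows $\mathcal{H}$ is proper at an object $y$ if every sequence $(g_i)$ in $\mathcal{H}$ with $(s(g_i),t(g_i))\to(y,y)$ has a convergent subsequence. A Morita equivalence between Lie groupoids $\mathcal{H}$ over $N$ and $\mathcal{K}$ over $M'$ is a principal $\mathcal{H}$-$\mathcal{K}$ bi-bundle: a manifold $P$ with surjective submersions $\alpha:P\to N$, $\beta:P\to M'$, a left action of $\mathcal{H}$ along $\alpha$ and a right action of $\mathcal{K}$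 along $\beta$, which commute, such that $\beta$ is a principal $\mathcal{H}$-bundle (i.e. $(h,p)\mapsto(hp,p)$ is a diffeomorphism $\mathcal{H}\times_N P\to P\times_{M'}P$) and $\alpha$ is a principal $\mathcal{K}$-bundle (i.e. $(p,k)\mapsto(p,pk)$ is a diffeomorphism $P\times_{M'}\mathcal{K}\to P\times_N P$). Let $\Sigma$ be a slice at $x$. Then: 1. $\mathcal{G}|_\Sigma$ is an embedded submanifold of $\mathcal{G}$ and, with the restricted structure maps, a Lie groupoid over $\Sigma$, which has $x$ as a fixed point (the orbit of $x$ under $\mathcal{G}|_\Sigma$ is $\{x\}$). 2. The saturation $U$ of $\Sigma$ (the union of all orbits of $\mathcal{G}$ that meet $\Sigma$) is open in $M$, and $\mathcal{G}|_\Sigma$ is Morita equivalent to $\mathcal{G}|_U$. 3. $\mathcal{G}$ is proper at $x$ if and only if $\mathcal{G}|_\Sigma$ is proper at $x$. -/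

import Mathlib

open Set Filter Topology Manifold TopologicalSpace
open scoped ContDiff

namespace LieGpd

universe u v

/-- An (algebraic) groupoid with set of objects `M` and set of arrows `G`; an arrow `g` goes from
`src g` to `tgt g`.  The product `mul g h` is the composition `gh`, which is meaningful only when
`src g = tgt h`: nothing is required of, and nothing below depends on, its other values. -/
structure Gpd (G : Type v) (M : Type u) where
  src : G → M
  tgt : G → M
  mul : G → G → G
  one : M → G
  inv : G → G
  src_mul : ∀ g h, src g = tgt h → src (mul g h) = src h
  tgt_mul : ∀ g h, src g = tgt h → tgt (mul g h) = tgt g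
  mul_assoc : ∀ g h k, src g = tgt h → src h = tgt k → mul (mul g h) k = mul g (mul h k)
  src_one : ∀ x, src (one x) = x
  tgt_one : ∀ x, tgt (one x) = x
  one_mul : ∀ g, mul (one (tgt g)) g = g
  mul_one : ∀ g, mul g (one (src g)) = g
  src_inv : ∀ g, src (inv g) = tgt g
  tgt_inv : ∀ g, tgt (inv g) = src g
  inv_mul : ∀ g, mul (inv g) g = one (src g)
  mul_inv : ∀ g, mul g (inv g) = one (tgt g)

namespace Gpd

variable {G : Type v} {M : Type u}

/-- The orbit of `x`: all `y` for which there is an arrow from `x` to `y`. -/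
def orbit (𝒢 : Gpd G M) (x : M) : Set M := {y | ∃ g, 𝒢.src g = x ∧ 𝒢.tgt g = y}

/-- The saturation of `S`: the union of all orbits that meet `S`. -/
def saturation (𝒢 : Gpd G M) (S : Set M) : Set M := {y | (𝒢.orbit y ∩ S).Nonempty}

/-- `x` is a fixed point: its orbit is `{x}`. -/
def IsFixedPoint (𝒢 : Gpd G M) (x : M) : Prop := 𝒢.orbit x = {x}

/-- The set of pairs `(g, h)` of composable arrows. -/
def composable (𝒢 : Gpd G M) : Set (G × G) := {p | 𝒢.src p.1 = 𝒢.tgt p.2}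

open Classical in
/-- The restriction of a groupoid to the objects that satisfy `B`; its arrows are the arrows (they
form the predicate `A`) both of whose ends satisfy `B`, with the operations of `𝒢`. -/
noncomputable def restrict (𝒢 : Gpd G M) {A : G → Prop} {B : M → Prop}
    (hA : ∀ g, A g ↔ B (𝒢.src g) ∧ B (𝒢.tgt g)) : Gpd {g // A g} {y // B y} where
  src g := ⟨𝒢.src g.1, ((hA g.1).1 g.2).1⟩
  tgt g := ⟨𝒢.tgt g.1, ((hA g.1).1 g.2).2⟩
  mul g h := if c : 𝒢.src g.1 = 𝒢.tgt h.1 then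
      ⟨𝒢.mul g.1 h.1, (hA _).2 ⟨by rw [𝒢.src_mul _ _ c]; exact ((hA h.1).1 h.2).1,
        by rw [𝒢.tgt_mul _ _ c]; exact ((hA g.1).1 g.2).2⟩⟩
    else g
  one y := ⟨𝒢.one y.1, (hA _).2 ⟨by rw [𝒢.src_one]; exact y.2, by rw [𝒢.tgt_one]; exact y.2⟩⟩
  inv g := ⟨𝒢.inv g.1, (hA _).2 ⟨by rw [𝒢.src_inv]; exact ((hA g.1).1 g.2).2,
    by rw [𝒢.tgt_inv]; exact ((hA g.1).1 g.2).1⟩⟩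
  src_mul g h c := by
    have c' := congrArg Subtype.val c
    simp only at c'
    simp [c', 𝒢.src_mul _ _ c']
  tgt_mul g h c := by
    have c' := congrArg Subtype.val c
    simp only at c'
    simp [c', 𝒢.tgt_mul _ _ c']
  mul_assoc g h k c d := by
    have c' := congrArg Subtype.val c
    have d' := congrArg Subtype.val d
    simp only at c' d'
    simp [c', d', 𝒢.src_mul _ _ c', 𝒢.tgt_mul _ _ d', 𝒢.mul_assoc _ _ _ c' d']
  src_one y := by simp [𝒢.src_one]
  tgt_one y := by simp [𝒢.tgt_one]
  one_mul g := by simp [𝒢.src_one, 𝒢.one_mul]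
  mul_one g := by simp [𝒢.tgt_one, 𝒢.mul_one]
  src_inv g := by simp [𝒢.src_inv]
  tgt_inv g := by simp [𝒢.tgt_inv]
  inv_mul g := by simp [𝒢.src_inv, 𝒢.inv_mul]
  mul_inv g := by simp [𝒢.tgt_inv, 𝒢.mul_inv]

/-- `𝒢` is proper at `x`: every sequence of arrows whose sources and targets converge to `x` has
a convergent subsequence. -/
def ProperAt [TopologicalSpace G] [TopologicalSpace M] (𝒢 : Gpd G M) (x : M) : Prop :=
  ∀ g : ℕ → G, Tendsto (fun i => (𝒢.src (g i), 𝒢.tgt (g i))) atTop (𝓝 (x, x)) →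
    ∃ (a : G) (φ : ℕ → ℕ), StrictMono φ ∧ Tendsto (fun i => g (φ i)) atTop (𝓝 a)

end Gpd

/-- `𝒢` is a Lie groupoid.  The manifold `G` of arrows has dimension `m` and the manifold `M` of
objects has dimension `n`; both are smooth, Hausdorff and second countable.  Since `src` and `tgt`
are submersions, the set of composable pairs is an embedded submanifold of `G × G`; for a map on
an embedded submanifold, being smooth is the same as `ContMDiffOn` (extending locally to a smooth
map of the ambient manifold). -/
structure IsLieGroupoid (m n : ℕ) {G : Type v} {M : Type u}
    [TopologicalSpace G] [ChartedSpace (EuclideanSpace ℝ (Fin m)) G] [IsManifold (𝓡 m) ∞ G]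
    [T2Space G] [SecondCountableTopology G]
    [TopologicalSpace M] [ChartedSpace (EuclideanSpace ℝ (Fin n)) M] [IsManifold (𝓡 n) ∞ M]
    [T2Space M] [SecondCountableTopology M]
    (𝒢 : Gpd G M) : Prop where
  src_submersion : IsSubmersion (𝓡 m) (𝓡 n) ∞ 𝒢.src
  tgt_submersion : IsSubmersion (𝓡 m) (𝓡 n) ∞ 𝒢.tgt
  mul_smooth : ContMDiffOn ((𝓡 m).prod (𝓡 m)) (𝓡 m) ∞ (fun p : G × G => 𝒢.mul p.1 p.2)
    𝒢.composable
  one_smooth : ContMDiff (𝓡 n) (𝓡 m) ∞ 𝒢.one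
  inv_smooth : ContMDiff (𝓡 m) (𝓡 m) ∞ 𝒢.inv

/-- An embedded submanifold of the `n`-dimensional manifold `X`: a subset with the structure of
a smooth manifold of some dimension `dim`, for the subspace topology, such that the inclusion is
a smooth embedding. -/
structure EmbeddedSubmanifold (n : ℕ) (X : Type u) [TopologicalSpace X]
    [ChartedSpace (EuclideanSpace ℝ (Fin n)) X] where
  carrier : Set X
  dim : ℕ
  charted : ChartedSpace (EuclideanSpace ℝ (Fin dim)) carrier
  isManifold : IsManifold (𝓡 dim) ∞ carrier
  isSmoothEmbedding : IsSmoothEmbedding (𝓡 dim) (𝓡 n) ∞ (Subtype.val : carrier → X)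

section

variable {n : ℕ} {X : Type u} [TopologicalSpace X] [ChartedSpace (EuclideanSpace ℝ (Fin n)) X]

instance (S : EmbeddedSubmanifold n X) :
    ChartedSpace (EuclideanSpace ℝ (Fin S.dim)) S.carrier := S.charted

instance (S : EmbeddedSubmanifold n X) : IsManifold (𝓡 S.dim) ∞ S.carrier := S.isManifold

/-- The tangent space of `S` at `y`, as a subspace of the tangent space of the ambient manifold. -/
noncomputable def EmbeddedSubmanifold.tangent (S : EmbeddedSubmanifold n X) (y : S.carrier) :
    Submodule ℝ (TangentSpace (𝓡 n) (y : X)) :=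
  LinearMap.range (mfderiv (𝓡 S.dim) (𝓡 n) (Subtype.val : S.carrier → X) y).toLinearMap

end

section

variable (m n : ℕ) {G : Type v} {M : Type u}
  [TopologicalSpace G] [ChartedSpace (EuclideanSpace ℝ (Fin m)) G]
  [TopologicalSpace M] [ChartedSpace (EuclideanSpace ℝ (Fin n)) M]

/-- The tangent space at `y` of the orbit `𝒪` through `y`, as a subspace of the tangent space of
`M`.  The smooth structure of `𝒪` is the one for which `tgt : src⁻¹(y) → 𝒪` is a submersion, and
`tgt (one y) = y`; hence this tangent space is the image under the differential of `tgt` of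
the tangent space `ker d(src)` of `src⁻¹(y)` at the unit `one y`. -/
noncomputable def Gpd.orbitTangent (𝒢 : Gpd G M) (y : M) :
    Submodule ℝ (TangentSpace (𝓡 n) y) :=
  Submodule.map (mfderiv (𝓡 m) (𝓡 n) 𝒢.tgt (𝒢.one y)).toLinearMap
    (LinearMap.ker (mfderiv (𝓡 m) (𝓡 n) 𝒢.src (𝒢.one y)).toLinearMap)

/-- `S` is a slice at `x` for the Lie groupoid `𝒢`: it contains `x`, it is transversal to every
orbit that it meets, its dimension is complementary to that of the orbit of `x`, and it meets
the orbit of `x` in `x` only. -/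
structure IsSlice (𝒢 : Gpd G M) (S : EmbeddedSubmanifold n M) (x : M) : Prop where
  mem : x ∈ S.carrier
  transversal : ∀ y : S.carrier, S.tangent y ⊔ 𝒢.orbitTangent m n (y : M) = ⊤
  dim_add : S.dim + Module.finrank ℝ (𝒢.orbitTangent m n x) = n
  inter_orbit : S.carrier ∩ 𝒢.orbit x = {x}

end

/-- `f` restricts to a diffeomorphism between the embedded submanifolds `A` of `X` and `B`
of `Y`. -/
def IsDiffeoOn {E H X E' H' Y : Type*} [NormedAddCommGroup E] [NormedSpace ℝ E]
    [TopologicalSpace H] (I : ModelWithCorners ℝ E H) [TopologicalSpace X] [ChartedSpace H X]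
    [NormedAddCommGroup E'] [NormedSpace ℝ E'] [TopologicalSpace H']
    (J : ModelWithCorners ℝ E' H') [TopologicalSpace Y] [ChartedSpace H' Y]
    (f : X → Y) (A : Set X) (B : Set Y) : Prop :=
  MapsTo f A B ∧ ContMDiffOn I J ∞ f A ∧
    ∃ f' : Y → X, MapsTo f' B A ∧ ContMDiffOn J I ∞ f' B ∧ InvOn f' f A B

/-- A principal `ℋ`-`𝒢` bi-bundle: a manifold `P` (of dimension `p`) with surjective submersions
`α : P → N` and `β : P → M` to the objects of `ℋ` and of `𝒢`, a left action `hq` of `ℋ` (defined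
when `src h = α q`) along the fibres of `α` and a right action `qg` of `𝒢` (defined when
`β q = tgt g`) along the fibres of `β`, which commute and make `β` a principal `ℋ`-bundle and `α`
a principal `𝒢`-bundle.  The values of the actions outside their domains do not matter. -/
structure PrincipalBibundle (p k l m n : ℕ) {H G : Type v} {N M : Type u}
    [TopologicalSpace H] [ChartedSpace (EuclideanSpace ℝ (Fin k)) H]
    [TopologicalSpace N] [ChartedSpace (EuclideanSpace ℝ (Fin l)) N]
    [TopologicalSpace G] [ChartedSpace (EuclideanSpace ℝ (Fin m)) G]
    [TopologicalSpace M] [ChartedSpace (EuclideanSpace ℝ (Fin n)) M]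
    (ℋ : Gpd H N) (𝒢 : Gpd G M)
    (P : Type v) [TopologicalSpace P] [ChartedSpace (EuclideanSpace ℝ (Fin p)) P] where
  α : P → N
  β : P → M
  α_surjective : Function.Surjective α
  α_submersion : IsSubmersion (𝓡 p) (𝓡 l) ∞ α
  β_surjective : Function.Surjective β
  β_submersion : IsSubmersion (𝓡 p) (𝓡 n) ∞ β
  lact : H → P → P
  ract : P → G → P
  α_lact : ∀ h q, ℋ.src h = α q → α (lact h q) = ℋ.tgt h
  β_lact : ∀ h q, ℋ.src h = α q → β (lact h q) = β q
  one_lact : ∀ q, lact (ℋ.one (α q)) q = q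
  mul_lact : ∀ h h' q, ℋ.src h = ℋ.tgt h' → ℋ.src h' = α q →
    lact (ℋ.mul h h') q = lact h (lact h' q)
  β_ract : ∀ q g, β q = 𝒢.tgt g → β (ract q g) = 𝒢.src g
  α_ract : ∀ q g, β q = 𝒢.tgt g → α (ract q g) = α q
  ract_one : ∀ q, ract q (𝒢.one (β q)) = q
  ract_mul : ∀ q g g', β q = 𝒢.tgt g → 𝒢.src g = 𝒢.tgt g' →
    ract q (𝒢.mul g g') = ract (ract q g) g'
  lact_ract : ∀ h q g, ℋ.src h = α q → β q = 𝒢.tgt g →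
    lact h (ract q g) = ract (lact h q) g
  left_principal : IsDiffeoOn ((𝓡 k).prod (𝓡 p)) ((𝓡 p).prod (𝓡 p))
    (fun z : H × P => (lact z.1 z.2, z.2)) {z | ℋ.src z.1 = α z.2} {z | β z.1 = β z.2}
  right_principal : IsDiffeoOn ((𝓡 p).prod (𝓡 m)) ((𝓡 p).prod (𝓡 p))
    (fun z : P × G => (z.1, ract z.1 z.2)) {z | β z.1 = 𝒢.tgt z.2} {z | α z.1 = α z.2}

/-- `ℋ` (with arrows of dimension `k`, objects of dimension `l`) and `𝒢` (with arrows of dimension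
`m`, objects of dimension `n`) are Morita equivalent Lie groupoids: both are Lie groupoids, and
a principal `ℋ`-`𝒢` bi-bundle exists. -/
def MoritaEquivalent (k l m n : ℕ) {H G : Type v} {N M : Type u}
    [TopologicalSpace H] [ChartedSpace (EuclideanSpace ℝ (Fin k)) H] [IsManifold (𝓡 k) ∞ H]
    [T2Space H] [SecondCountableTopology H]
    [TopologicalSpace N] [ChartedSpace (EuclideanSpace ℝ (Fin l)) N] [IsManifold (𝓡 l) ∞ N]
    [T2Space N] [SecondCountableTopology N]
    [TopologicalSpace G] [ChartedSpace (EuclideanSpace ℝ (Fin m)) G] [IsManifold (𝓡 m) ∞ G]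
    [T2Space G] [SecondCountableTopology G]
    [TopologicalSpace M] [ChartedSpace (EuclideanSpace ℝ (Fin n)) M] [IsManifold (𝓡 n) ∞ M]
    [T2Space M] [SecondCountableTopology M]
    (ℋ : Gpd H N) (𝒢 : Gpd G M) : Prop :=
  IsLieGroupoid k l ℋ ∧ IsLieGroupoid m n 𝒢 ∧
    ∃ (p : ℕ) (P : Type v) (_ : TopologicalSpace P)
      (_ : ChartedSpace (EuclideanSpace ℝ (Fin p)) P), IsManifold (𝓡 p) ∞ P ∧ T2Space P ∧
        SecondCountableTopology P ∧ Nonempty (PrincipalBibundle p k l m n ℋ 𝒢 P)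

end LieGpd

/-! Everything rests on one consequence of transversality: the source map restricted to `tgt⁻¹(S)`
is a submersion. Right translation by `g` carries `ker d(src)` at the unit of `tgt g` into `ker
d(src)` at `g` without changing targets, so at `g` the image of `ker d(src)` under `d(tgt)` contains
the orbit directions at `tgt g` (`exists_mfderiv_tgt_eq`). If `f` cuts out `S` near `tgt g`, these
directions together with `T S = ker df` span the tangent space, so `(d src, d(f ∘ tgt))` is onto.
Hence through every arrow with target in `S` passes a smooth local section of `src` whose values
keep their targets in `S` (`exists_section_src`).

The same surjectivity makes the arrows with both ends in `S` a regular zero set, hence an embedded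
submanifold. The local sections show that its source map is a submersion, and that the saturation,
being the image of `tgt⁻¹(S)` under `src`, is open. The bibundle is `tgt⁻¹(S)` itself, with anchors
`tgt` and `src` and with multiplication on either side; the divisions `q q'⁻¹` and `q⁻¹ q'` make it
principal (`nonempty_principalBibundle`). For properness, a section `τ` through the unit at `x`
turns an arrow `g` with ends near `x` into `τ(tgt g) g τ(src g)⁻¹`, which has both ends in `S`; as
`τ` is continuous, convergence transfers back (`properAt_of_restrict`).

The differential geometry is organised around local sections: surjective differentials produce them,
they recognise submersions, and smoothness of maps into submanifolds is tested in the ambient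
manifold. -/

/-! ### Inverse function theorem and the normal form of submersions -/

theorem ContinuousLinearMap.exists_equiv_prod_snd_eq {n k : ℕ} {F : Type*} [NormedAddCommGroup F]
    [NormedSpace ℝ F] [FiniteDimensional ℝ F] (D : EuclideanSpace ℝ (Fin n) →L[ℝ] F)
    (hD : Function.Surjective D) (hk : Module.finrank ℝ F + k = n) :
    ∃ e : EuclideanSpace ℝ (Fin n) ≃L[ℝ] EuclideanSpace ℝ (Fin k) × F, ∀ v, (e v).2 = D v := by
  have hr : Module.finrank ℝ (LinearMap.range (D : EuclideanSpace ℝ (Fin n) →ₗ[ℝ] F)) =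
      Module.finrank ℝ F := by
    rw [LinearMap.range_eq_top.2 hD, finrank_top]
  have h := LinearMap.finrank_range_add_finrank_ker (D : EuclideanSpace ℝ (Fin n) →ₗ[ℝ] F)
  rw [finrank_euclideanSpace_fin, hr] at h
  obtain ⟨p, hp⟩ := (LinearMap.ker (D : EuclideanSpace ℝ (Fin n) →ₗ[ℝ] F)).exists_isCompl
  let e₀ : LinearMap.ker (D : EuclideanSpace ℝ (Fin n) →ₗ[ℝ] F) ≃ₗ[ℝ] EuclideanSpace ℝ (Fin k) :=
    LinearEquiv.ofFinrankEq _ _ (by rw [finrank_euclideanSpace_fin]; omega)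
  let e₁ := LinearMap.equivProdOfSurjectiveOfIsCompl
    (e₀.toLinearMap ∘ₗ Submodule.projectionOnto _ p hp)
    (D : EuclideanSpace ℝ (Fin n) →ₗ[ℝ] F)
    (by rw [LinearMap.range_eq_top]
        exact e₀.surjective.comp (LinearMap.range_eq_top.1 (Submodule.range_projectionOnto hp)))
    (LinearMap.range_eq_top.2 hD)
    (by rw [LinearEquiv.ker_comp, Submodule.ker_projectionOnto]; exact hp.symm)
  exact ⟨e₁.toContinuousLinearEquiv, fun v => rfl⟩

theorem ContDiffOn.exists_openPartialHomeomorph {E : Type*} [NormedAddCommGroup E]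
    [NormedSpace ℝ E] [CompleteSpace E] {Φ : E → E} {O : Set E} {a : E} (hO : IsOpen O)
    (ha : a ∈ O) (hΦ : ContDiffOn ℝ ∞ Φ O) (hd : HasFDerivAt Φ (ContinuousLinearMap.id ℝ E) a) :
    ∃ φ : OpenPartialHomeomorph E E, a ∈ φ.source ∧ φ.source ⊆ O ∧ (φ : E → E) = Φ ∧
      ContDiffOn ℝ ∞ φ φ.source ∧ ContDiffOn ℝ ∞ φ.symm φ.target := by
  have hat : ContDiffAt ℝ ∞ Φ a := hΦ.contDiffAt (hO.mem_nhds ha)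
  have hd' : HasFDerivAt Φ ((ContinuousLinearEquiv.refl ℝ E : E ≃L[ℝ] E) : E →L[ℝ] E) a := hd
  let φ₀ := hat.toOpenPartialHomeomorph Φ hd' (by simp)
  -- The inverse is smooth at the image of any point where the derivative is invertible, so the
  -- source is cut down to those points; they form an open set because units are open.
  let T : Set E := O ∩ {v | IsUnit (fderiv ℝ Φ v)}
  have hT : IsOpen T :=
    (hΦ.continuousOn_fderiv_of_isOpen hO (by simp)).isOpen_inter_preimage hO Units.isOpen
  have haT : a ∈ T := by
    refine ⟨ha, ?_⟩
    simp only [mem_ofPred_eq, hd.fderiv]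
    exact isUnit_one
  have hc : ((φ₀.restr T : OpenPartialHomeomorph E E) : E → E) = Φ := rfl
  refine ⟨φ₀.restr T, ?_, ?_, hc, ?_, ?_⟩
  · rw [φ₀.restr_source' _ hT]
    exact ⟨hat.mem_toOpenPartialHomeomorph_source hd' (by simp), haT⟩
  · rw [φ₀.restr_source' _ hT]
    exact fun v hv => hv.2.1
  · rw [hc, φ₀.restr_source' _ hT]
    exact hΦ.mono fun v hv => hv.2.1
  · intro w hw
    have hs := (φ₀.restr T).map_target hw
    rw [φ₀.restr_source' _ hT] at hs
    obtain ⟨u, hu⟩ := hs.2.2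
    have hΦat := hΦ.contDiffAt (hO.mem_nhds hs.2.1)
    refine ((φ₀.restr T).contDiffAt_symm (f₀' := ContinuousLinearEquiv.ofUnit u) hw ?_
      hΦat).contDiffWithinAt
    rw [hc]
    have := (hΦat.differentiableAt (by simp)).hasFDerivAt
    rw [← hu] at this
    exact this

section

variable {n : ℕ} {X : Type*} [TopologicalSpace X] [ChartedSpace (EuclideanSpace ℝ (Fin n)) X]
  [IsManifold (𝓡 n) ∞ X] {F : Type*} [NormedAddCommGroup F] [NormedSpace ℝ F]
  [FiniteDimensional ℝ F]

/-- In linear coordinates `e` whose second component is the differential of `f`, replacing that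
component by `f` itself gives a map with derivative the identity at `a`, hence a local change of
coordinates that makes `f` a projection. -/
theorem ContMDiffOn.exists_adapted_chart {k : ℕ} {f : X → F} {W : Set X} {a : X}
    (hk : Module.finrank ℝ F + k = n) (hW : IsOpen W) (ha : a ∈ W)
    (hf : ContMDiffOn (𝓡 n) 𝓘(ℝ, F) ∞ f W)
    (hs : Function.Surjective (mfderiv (𝓡 n) 𝓘(ℝ, F) f a)) :
    ∃ ψ ∈ IsManifold.maximalAtlas (𝓡 n) ∞ X, a ∈ ψ.source ∧ ψ.source ⊆ W ∧
      ∃ e : EuclideanSpace ℝ (Fin n) ≃L[ℝ] EuclideanSpace ℝ (Fin k) × F,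
        ∀ p ∈ ψ.source, (e (ψ p)).2 = f p := by
  let χ := chartAt (EuclideanSpace ℝ (Fin n)) a
  have haχ : a ∈ χ.source := mem_chart_source _ a
  have hχ : χ ∈ IsManifold.maximalAtlas (𝓡 n) ∞ X := IsManifold.chart_mem_maximalAtlas a
  let O : Set (EuclideanSpace ℝ (Fin n)) := χ.target ∩ χ.symm ⁻¹' W
  have hO : IsOpen O := χ.isOpen_inter_preimage_symm hW
  have haO : χ a ∈ O := ⟨χ.map_source haχ, by simpa [χ.left_inv haχ] using ha⟩
  let g : EuclideanSpace ℝ (Fin n) → F := f ∘ χ.symm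
  have hg : ContDiffOn ℝ ∞ g O := by
    rw [← contMDiffOn_iff_contDiffOn]
    exact hf.comp ((contMDiffOn_symm_of_mem_maximalAtlas hχ).mono inter_subset_left)
      inter_subset_right
  have hgd : DifferentiableAt ℝ g (χ a) :=
    (hg.contDiffAt (hO.mem_nhds haO)).differentiableAt (by simp)
  have hχd : MDifferentiableAt (𝓡 n) (𝓡 n) χ a :=
    (contMDiffAt_of_mem_maximalAtlas hχ haχ).mdifferentiableAt (by simp)
  have hfg : f =ᶠ[𝓝 a] g ∘ χ := by
    filter_upwards [χ.open_source.mem_nhds haχ] with p hp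
    simp [g, χ.left_inv hp]
  have hD : Function.Surjective (fderiv ℝ g (χ a)) := by
    rw [hfg.mfderiv_eq, mfderiv_comp a hgd.mdifferentiableAt hχd, mfderiv_eq_fderiv] at hs
    exact Function.Surjective.of_comp hs
  obtain ⟨e, he⟩ := (fderiv ℝ g (χ a)).exists_equiv_prod_snd_eq hD hk
  let Φ : EuclideanSpace ℝ (Fin n) → EuclideanSpace ℝ (Fin n) := fun v => e.symm ((e v).1, g v)
  have hΦ : ContDiffOn ℝ ∞ Φ O := by
    refine e.symm.contDiff.comp_contDiffOn (ContDiffOn.prodMk ?_ hg)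
    exact (contDiff_fst.comp e.contDiff).contDiffOn
  have hΦd : HasFDerivAt Φ (ContinuousLinearMap.id ℝ _) (χ a) := by
    refine HasFDerivAt.congr_fderiv (e.symm.hasFDerivAt.comp (χ a)
      ((e.hasFDerivAt (x := χ a)).fst.prodMk hgd.hasFDerivAt)) ?_
    ext1 v
    change e.symm ((e v).1, fderiv ℝ g (χ a) v) = v
    rw [← he v]
    simp
  obtain ⟨φ, haφ, hφO, hφc, hφ1, hφ2⟩ := hΦ.exists_openPartialHomeomorph hO haO hΦd
  refine ⟨χ ≫ₕ φ, ?_, ?_, ?_, e, ?_⟩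
  · apply OpenPartialHomeomorph.mem_maximalAtlas_of_contMDiffOn
    · rw [OpenPartialHomeomorph.coe_trans]
      exact (contMDiffOn_iff_contDiffOn.2 hφ1).comp
        ((contMDiffOn_of_mem_maximalAtlas hχ).mono (by intro p hp; simp_all)) (by
          intro p hp; simp_all)
    · rw [OpenPartialHomeomorph.coe_trans_symm]
      exact (contMDiffOn_symm_of_mem_maximalAtlas hχ).comp
        ((contMDiffOn_iff_contDiffOn.2 hφ2).mono (by intro p hp; simp_all)) (by
          intro p hp; simp_all)
  · simp [haχ, haφ]
  · intro p hp
    rw [OpenPartialHomeomorph.trans_source] at hp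
    have := (hφO hp.2).2
    simpa [χ.left_inv hp.1] using this
  · intro p hp
    rw [OpenPartialHomeomorph.trans_source] at hp
    simp [hφc, Φ, g, χ.left_inv hp.1]

end

section

variable {n : ℕ} {X : Type*} [TopologicalSpace X] [ChartedSpace (EuclideanSpace ℝ (Fin n)) X]

theorem finrank_le_of_mfderiv_surjective {F : Type*} [NormedAddCommGroup F] [NormedSpace ℝ F]
    {f : X → F} {a : X}
    (hs : Function.Surjective (mfderiv (𝓡 n) 𝓘(ℝ, F) f a)) : Module.finrank ℝ F ≤ n := by
  obtain ⟨T, hT⟩ : ∃ T : EuclideanSpace ℝ (Fin n) →ₗ[ℝ] F, Function.Surjective T :=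
    ⟨(mfderiv (𝓡 n) 𝓘(ℝ, F) f a).toLinearMap, hs⟩
  have h := LinearMap.finrank_le_finrank_of_surjective hT
  rwa [finrank_euclideanSpace_fin] at h

variable [IsManifold (𝓡 n) ∞ X] {F : Type*} [NormedAddCommGroup F] [NormedSpace ℝ F]
  [FiniteDimensional ℝ F] {f : X → F} {W : Set X} {a : X}

/-- In an adapted chart the section freezes the complementary coordinates at those of `a`. -/
theorem ContMDiffOn.exists_local_section (hW : IsOpen W) (ha : a ∈ W)
    (hf : ContMDiffOn (𝓡 n) 𝓘(ℝ, F) ∞ f W)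
    (hs : Function.Surjective (mfderiv (𝓡 n) 𝓘(ℝ, F) f a)) :
    ∃ (σ : F → X) (O : Set F), IsOpen O ∧ f a ∈ O ∧ ContMDiffOn 𝓘(ℝ, F) (𝓡 n) ∞ σ O ∧
      σ (f a) = a ∧ ∀ v ∈ O, σ v ∈ W ∧ f (σ v) = v := by
  obtain ⟨ψ, hψ, haψ, hψW, e, he⟩ := hf.exists_adapted_chart
    (Nat.add_sub_of_le (finrank_le_of_mfderiv_surjective hs)) hW ha hs
  let j : F → EuclideanSpace ℝ (Fin n) := fun v => e.symm ((e (ψ a)).1, v)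
  have hj : ContDiff ℝ ∞ j := e.symm.contDiff.comp (contDiff_const.prodMk contDiff_id)
  have hja : j (f a) = ψ a := by simp [j, ← he a haψ]
  refine ⟨ψ.symm ∘ j, j ⁻¹' ψ.target, ψ.open_target.preimage hj.continuous, ?_, ?_, ?_, ?_⟩
  · simpa [hja] using ψ.map_source haψ
  · exact (contMDiffOn_symm_of_mem_maximalAtlas hψ).comp hj.contMDiff.contMDiffOn
      (fun _ h => h)
  · simp [hja, ψ.left_inv haψ]
  · intro v hv
    have hv' := ψ.map_target hv
    refine ⟨hψW hv', ?_⟩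
    simp only [Function.comp_apply]
    rw [← he _ hv', ψ.right_inv hv]
    simp [j]

/-- In an adapted chart the curve is a straight line; its direction has no `F`-component because `η`
is killed by the differential of `f`, so the line stays in the fibre. -/
theorem ContMDiffOn.exists_curve_in_fiber (hW : IsOpen W) (ha : a ∈ W)
    (hf : ContMDiffOn (𝓡 n) 𝓘(ℝ, F) ∞ f W)
    (hs : Function.Surjective (mfderiv (𝓡 n) 𝓘(ℝ, F) f a)) (η : TangentSpace (𝓡 n) a)
    (hη : mfderiv (𝓡 n) 𝓘(ℝ, F) f a η = 0) :
    ∃ (c : ℝ → X) (O : Set ℝ), IsOpen O ∧ 0 ∈ O ∧ ContMDiffOn 𝓘(ℝ, ℝ) (𝓡 n) ∞ c O ∧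
      c 0 = a ∧ (∀ r ∈ O, c r ∈ W ∧ f (c r) = f a) ∧
      (mfderiv 𝓘(ℝ, ℝ) (𝓡 n) c 0 (1 : ℝ) : EuclideanSpace ℝ (Fin n)) = η := by
  obtain ⟨ψ, hψ, haψ, hψW, e, he⟩ := hf.exists_adapted_chart
    (Nat.add_sub_of_le (finrank_le_of_mfderiv_surjective hs)) hW ha hs
  have hψd : MDifferentiableAt (𝓡 n) (𝓡 n) ψ a :=
    (contMDiffAt_of_mem_maximalAtlas hψ haψ).mdifferentiableAt (by simp)
  have hψd' : MDifferentiableAt (𝓡 n) (𝓡 n) ψ.symm (ψ a) :=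
    (contMDiffAt_symm_of_mem_maximalAtlas hψ (ψ.map_source haψ)).mdifferentiableAt (by simp)
  let w : EuclideanSpace ℝ (Fin n) := mfderiv (𝓡 n) (𝓡 n) ψ a η
  have hw : (e w).2 = 0 := by
    have h1 : f =ᶠ[𝓝 a] (fun v => (e v).2) ∘ ψ := by
      filter_upwards [ψ.open_source.mem_nhds haψ] with p hp using (he p hp).symm
    have h2 := (e.hasFDerivAt (x := ψ a)).snd
    rw [h1.mfderiv_eq, mfderiv_comp a h2.differentiableAt.mdifferentiableAt hψd,
      mfderiv_eq_fderiv, h2.fderiv] at hη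
    exact hη
  let j : ℝ → EuclideanSpace ℝ (Fin n) := fun r => ψ a + r • w
  have hj : ContDiff ℝ ∞ j := contDiff_const.add (contDiff_id.smul contDiff_const)
  have hj0 : j 0 = ψ a := by simp [j]
  have hjd : HasFDerivAt j (ContinuousLinearMap.toSpanSingleton ℝ w) 0 := by
    have := (((hasDerivAt_id (0 : ℝ)).smul_const w).const_add (ψ a)).hasFDerivAt
    rwa [one_smul] at this
  refine ⟨ψ.symm ∘ j, j ⁻¹' ψ.target, ψ.open_target.preimage hj.continuous, ?_, ?_, ?_, ?_, ?_⟩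
  · simpa [hj0] using ψ.map_source haψ
  · exact (contMDiffOn_symm_of_mem_maximalAtlas hψ).comp hj.contMDiff.contMDiffOn
      (fun _ h => h)
  · simp [hj0, ψ.left_inv haψ]
  · intro v hv
    have hv' := ψ.map_target hv
    refine ⟨hψW hv', ?_⟩
    simp only [Function.comp_apply]
    rw [← he _ hv', ψ.right_inv hv, ← he _ haψ]
    simp [j, hw]
  · rw [mfderiv_comp 0 (by rwa [hj0]) hjd.differentiableAt.mdifferentiableAt, mfderiv_eq_fderiv,
      hjd.fderiv, hj0]
    have h3 : mfderiv (𝓡 n) (𝓡 n) (ψ.symm ∘ ψ) a = ContinuousLinearMap.id ℝ _ := by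
      rw [← mfderiv_id]
      apply EventuallyEq.mfderiv_eq
      filter_upwards [ψ.open_source.mem_nhds haψ] with p hp using ψ.left_inv hp
    rw [mfderiv_comp a hψd' hψd] at h3
    refine Eq.trans (congrArg (mfderiv (𝓡 n) (𝓡 n) ψ.symm (ψ a)) ?_) (congrArg (fun T => T η) h3)
    exact one_smul ℝ w

end

/-! ### Submersions and surjective differentials -/

section

variable {E H X E' H' Y : Type*} [NormedAddCommGroup E] [NormedSpace ℝ E] [TopologicalSpace H]
  {I : ModelWithCorners ℝ E H} [TopologicalSpace X] [ChartedSpace H X]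
  [NormedAddCommGroup E'] [NormedSpace ℝ E'] [TopologicalSpace H']
  {J : ModelWithCorners ℝ E' H'} [TopologicalSpace Y] [ChartedSpace H' Y]

theorem mfderiv_surjective_of_section {f : X → Y} {σ : Y → X} {a : X}
    (hf : MDifferentiableAt I J f a) (hσ : MDifferentiableAt J I σ (f a)) (ha : σ (f a) = a)
    (h : ∀ᶠ y in 𝓝 (f a), f (σ y) = y) : Function.Surjective (mfderiv I J f a) := by
  have h1 : mfderiv J J (f ∘ σ) (f a) = ContinuousLinearMap.id ℝ _ := by
    rw [← mfderiv_id]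
    exact EventuallyEq.mfderiv_eq h
  rw [mfderiv_comp (f a) (by rwa [ha]) hσ] at h1
  intro v
  rw [ha] at h1
  exact ⟨mfderiv J I σ (f a) v, congrArg (fun T => T v) h1⟩

end

section

variable {n l : ℕ} {X Y : Type*} [TopologicalSpace X] [ChartedSpace (EuclideanSpace ℝ (Fin n)) X]
  [TopologicalSpace Y] [ChartedSpace (EuclideanSpace ℝ (Fin l)) Y] {f : X → Y}

/-- The normal form in charts supplies a smooth local section through `a`, and the chain rule does
the rest. -/
theorem Manifold.IsSubmersionAt.mfderiv_surjective {a : X}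
    (hf : IsSubmersionAt (𝓡 n) (𝓡 l) ∞ f a) :
    Function.Surjective (mfderiv (𝓡 n) (𝓡 l) f a) := by
  have hfd := hf.contMDiffAt.mdifferentiableAt (by simp)
  obtain ⟨φ, χ, K, _, _, e, haφ, haχ, hφ, hχ, hsub, hw⟩ :
      ∃ (φ : OpenPartialHomeomorph X (EuclideanSpace ℝ (Fin n)))
        (χ : OpenPartialHomeomorph Y (EuclideanSpace ℝ (Fin l)))
        (K : Type) (_ : NormedAddCommGroup K) (_ : NormedSpace ℝ K)
        (e : EuclideanSpace ℝ (Fin n) ≃L[ℝ] EuclideanSpace ℝ (Fin l) × K),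
        a ∈ φ.source ∧ f a ∈ χ.source ∧ φ ∈ IsManifold.maximalAtlas (𝓡 n) ∞ X ∧
        χ ∈ IsManifold.maximalAtlas (𝓡 l) ∞ Y ∧ φ.source ⊆ f ⁻¹' χ.source ∧
        EqOn ((χ.extend (𝓡 l)) ∘ f ∘ (φ.extend (𝓡 n)).symm) (Prod.fst ∘ e)
          (φ.extend (𝓡 n)).target :=
    ⟨hf.domChart, hf.codChart, hf.complement, inferInstance, inferInstance, hf.equiv,
      hf.mem_domChart_source, hf.mem_codChart_source, hf.domChart_mem_maximalAtlas,
      hf.codChart_mem_maximalAtlas, hf.source_subset_preimage_source, hf.writtenInCharts⟩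
  replace hw : ∀ p ∈ φ.source, χ (f p) = (e (φ p)).1 := by
    intro p hp
    have h : χ (f (φ.symm (φ p))) = (e (φ p)).1 :=
      hw (show φ p ∈ (φ.extend (𝓡 n)).target by simpa using φ.map_source hp)
    rwa [φ.left_inv hp] at h
  let j : EuclideanSpace ℝ (Fin l) → EuclideanSpace ℝ (Fin n) :=
    fun v => e.symm (v, (e (φ a)).2)
  have hj : ContDiff ℝ ∞ j := e.symm.contDiff.comp (contDiff_id.prodMk contDiff_const)
  have hja : j (χ (f a)) = φ a := by simp [j, hw a haφ]
  have hσ : ContMDiffAt (𝓡 l) (𝓡 n) ∞ (φ.symm ∘ j ∘ χ) (f a) := by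
    refine ContMDiffAt.comp (f a) ?_ (hj.contMDiff.contMDiffAt.comp (f a)
      (contMDiffAt_of_mem_maximalAtlas hχ haχ))
    simp only [Function.comp_apply, hja]
    exact contMDiffAt_symm_of_mem_maximalAtlas hφ (φ.map_source haφ)
  refine mfderiv_surjective_of_section hfd
    (hσ.mdifferentiableAt (by simp)) ?_ ?_
  · simp [hja, φ.left_inv haφ]
  · have h1 : ContinuousAt (j ∘ χ) (f a) :=
      hj.continuous.continuousAt.comp (χ.continuousAt haχ)
    filter_upwards [χ.open_source.mem_nhds haχ,
      h1.preimage_mem_nhds (φ.open_target.mem_nhds (by simpa [hja] using φ.map_source haφ)),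
      hσ.continuousAt.preimage_mem_nhds (φ.open_source.mem_nhds
        (by simpa [hja, φ.left_inv haφ] using haφ))] with y hy1 hy2 hy3
    have hy3' : φ.symm (j (χ y)) ∈ φ.source := hy3
    have hy2' : j (χ y) ∈ φ.target := hy2
    refine χ.injOn (hsub hy3) hy1 ?_
    simp only [Function.comp_apply]
    rw [hw _ hy3', φ.right_inv hy2']
    simp [j]

variable [IsManifold (𝓡 n) ∞ X] [IsManifold (𝓡 l) ∞ Y]

omit [IsManifold (𝓡 n) ∞ X] in
theorem mfderiv_chart_surjective {χ : OpenPartialHomeomorph X (EuclideanSpace ℝ (Fin n))}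
    (hχ : χ ∈ IsManifold.maximalAtlas (𝓡 n) ∞ X) {a : X} (ha : a ∈ χ.source) :
    Function.Surjective (mfderiv (𝓡 n) (𝓡 n) χ a) := by
  refine mfderiv_surjective_of_section (σ := χ.symm)
    ((contMDiffAt_of_mem_maximalAtlas hχ ha).mdifferentiableAt (by simp))
    ((contMDiffAt_symm_of_mem_maximalAtlas hχ (χ.map_source ha)).mdifferentiableAt (by simp))
    (χ.left_inv ha) ?_
  filter_upwards [χ.open_target.mem_nhds (χ.map_source ha)] with v hv using χ.right_inv hv

theorem ContMDiff.exists_local_section (hf : ContMDiff (𝓡 n) (𝓡 l) ∞ f) {a : X}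
    (hs : Function.Surjective (mfderiv (𝓡 n) (𝓡 l) f a))
    {W : Set X} (hW : IsOpen W) (haW : a ∈ W) :
    ∃ (τ : Y → X) (O : Set Y), IsOpen O ∧ f a ∈ O ∧ ContMDiffOn (𝓡 l) (𝓡 n) ∞ τ O ∧
      τ (f a) = a ∧ ∀ y ∈ O, f (τ y) = y ∧ τ y ∈ W := by
  let χ := chartAt (EuclideanSpace ℝ (Fin l)) (f a)
  have haχ : f a ∈ χ.source := mem_chart_source _ (f a)
  have hχ : χ ∈ IsManifold.maximalAtlas (𝓡 l) ∞ Y := IsManifold.chart_mem_maximalAtlas (f a)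
  have hg : ContMDiffOn (𝓡 n) 𝓘(ℝ, EuclideanSpace ℝ (Fin l)) ∞ (χ ∘ f) (f ⁻¹' χ.source ∩ W) :=
    (contMDiffOn_of_mem_maximalAtlas hχ).comp hf.contMDiffOn (fun _ h => h.1)
  obtain ⟨σ, O, hO, haO, hσ, hσa, hσO⟩ := hg.exists_local_section (a := a)
    ((χ.open_source.preimage hf.continuous).inter hW) ⟨haχ, haW⟩ (by
      rw [mfderiv_comp a ((contMDiffAt_of_mem_maximalAtlas hχ haχ).mdifferentiableAt (by simp))
        ((hf a).mdifferentiableAt (by simp))]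
      exact Function.Surjective.comp (g := mfderiv (𝓡 l) (𝓡 l) χ (f a))
        (mfderiv_chart_surjective hχ haχ) hs)
  refine ⟨σ ∘ χ, χ.source ∩ χ ⁻¹' O, χ.isOpen_inter_preimage hO, ⟨haχ, haO⟩,
    hσ.comp ((contMDiffOn_of_mem_maximalAtlas hχ).mono inter_subset_left) fun y hy => hy.2, hσa, ?_⟩
  rintro y ⟨hyχ, hyO⟩
  obtain ⟨⟨h1, h2⟩, h3⟩ := hσO _ hyO
  exact ⟨χ.injOn h1 hyχ h3, h2⟩

theorem ContMDiff.isSubmersion_of_mfderiv_surjective (hf : ContMDiff (𝓡 n) (𝓡 l) ∞ f)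
    (hs : ∀ a, Function.Surjective (mfderiv (𝓡 n) (𝓡 l) f a)) :
    IsSubmersion (𝓡 n) (𝓡 l) ∞ f := by
  -- One complement serves all points. The truncated subtraction is harmless: any point `a` yields
  -- `l ≤ n`, and without points there is nothing to prove.
  refine IsSubmersionOfComplement.isSubmersion (F := EuclideanSpace ℝ (Fin (n - l))) fun a => ?_
  let χ := chartAt (EuclideanSpace ℝ (Fin l)) (f a)
  have haχ : f a ∈ χ.source := mem_chart_source _ (f a)
  have hχ : χ ∈ IsManifold.maximalAtlas (𝓡 l) ∞ Y := IsManifold.chart_mem_maximalAtlas (f a)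
  have hfa : MDifferentiableAt (𝓡 n) (𝓡 l) f a := (hf a).mdifferentiableAt (by simp)
  have hχd : MDifferentiableAt (𝓡 l) (𝓡 l) χ (f a) :=
    (contMDiffAt_of_mem_maximalAtlas hχ haχ).mdifferentiableAt (by simp)
  have hW : IsOpen (f ⁻¹' χ.source) := χ.open_source.preimage hf.continuous
  have hg : ContMDiffOn (𝓡 n) 𝓘(ℝ, EuclideanSpace ℝ (Fin l)) ∞ (χ ∘ f) (f ⁻¹' χ.source) :=
    (contMDiffOn_of_mem_maximalAtlas hχ).comp hf.contMDiffOn (fun _ h => h)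
  have hgs : Function.Surjective (mfderiv (𝓡 n) 𝓘(ℝ, EuclideanSpace ℝ (Fin l)) (χ ∘ f) a) := by
    rw [mfderiv_comp a hχd hfa]
    exact Function.Surjective.comp (g := mfderiv (𝓡 l) (𝓡 l) χ (f a))
      (mfderiv_chart_surjective hχ haχ) (hs a)
  have hl := finrank_le_of_mfderiv_surjective hgs
  rw [finrank_euclideanSpace_fin] at hl
  obtain ⟨ψ, hψ, haψ, hψW, e, he⟩ := hg.exists_adapted_chart (k := n - l)
    (by rw [finrank_euclideanSpace_fin]; omega) hW haχ hgs
  refine IsSubmersionAtOfComplement.mk_of_charts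
    -- Adapted charts put `f` in the second factor, the normal form of a submersion in the first.
    (e.trans (ContinuousLinearEquiv.prodComm ℝ _ _)) ψ χ haψ haχ hψ hχ hψW ?_
  intro v hv
  have hv' : v ∈ ψ.target := by simpa using hv
  have := he _ (ψ.map_target hv')
  rw [ψ.right_inv hv'] at this
  simpa using this.symm
end

/-! ### Smooth maps into embedded submanifolds -/

section

variable {E H X : Type*} [NormedAddCommGroup E] [NormedSpace ℝ E] [TopologicalSpace H]
  {I : ModelWithCorners ℝ E H} [TopologicalSpace X] [ChartedSpace H X]
  {k n : ℕ} {N Y : Type*} [TopologicalSpace N] [ChartedSpace (EuclideanSpace ℝ (Fin k)) N]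
  [TopologicalSpace Y] [ChartedSpace (EuclideanSpace ℝ (Fin n)) Y]

/-- An immersion has smooth local left inverses. -/
theorem Manifold.IsImmersion.exists_local_retraction {ι : N → Y}
    (hι : IsImmersion (𝓡 k) (𝓡 n) ∞ ι) (y : N) :
    ∃ (ρ : Y → N) (T : Set N), IsOpen T ∧ y ∈ T ∧ ContMDiffAt (𝓡 n) (𝓡 k) ∞ ρ (ι y) ∧
      ∀ z ∈ T, ρ (ι z) = z := by
  have h := hι.isImmersionAt y
  obtain ⟨φ, χ, K, _, _, e, haφ, haχ, hφ, hχ, hw⟩ :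
      ∃ (φ : OpenPartialHomeomorph N (EuclideanSpace ℝ (Fin k)))
        (χ : OpenPartialHomeomorph Y (EuclideanSpace ℝ (Fin n)))
        (K : Type) (_ : NormedAddCommGroup K) (_ : NormedSpace ℝ K)
        (e : (EuclideanSpace ℝ (Fin k) × K) ≃L[ℝ] EuclideanSpace ℝ (Fin n)),
        y ∈ φ.source ∧ ι y ∈ χ.source ∧ φ ∈ IsManifold.maximalAtlas (𝓡 k) ∞ N ∧
        χ ∈ IsManifold.maximalAtlas (𝓡 n) ∞ Y ∧
        EqOn ((χ.extend (𝓡 n)) ∘ ι ∘ (φ.extend (𝓡 k)).symm) (e ∘ (·, 0))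
          (φ.extend (𝓡 k)).target :=
    ⟨h.domChart, h.codChart, h.complement, inferInstance, inferInstance, h.equiv,
      h.mem_domChart_source, h.mem_codChart_source, h.domChart_mem_maximalAtlas,
      h.codChart_mem_maximalAtlas, h.writtenInCharts⟩
  replace hw : ∀ z ∈ φ.source, (e.symm (χ (ι z))).1 = φ z := by
    intro z hz
    have h : χ (ι (φ.symm (φ z))) = e (φ z, 0) :=
      hw (show φ z ∈ (φ.extend (𝓡 k)).target by simpa using φ.map_source hz)
    rw [φ.left_inv hz] at h
    simp [h]
  -- In the charts `ι` is `u ↦ e (u, 0)`, so the first projection is a left inverse defined on the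
  -- ambient side.
  let j : EuclideanSpace ℝ (Fin n) → EuclideanSpace ℝ (Fin k) := fun v => (e.symm v).1
  have hj : ContDiff ℝ ∞ j := contDiff_fst.comp e.symm.contDiff
  refine ⟨φ.symm ∘ j ∘ χ, φ.source, φ.open_source, haφ, ?_, ?_⟩
  · refine ContMDiffAt.comp (ι y) ?_ (hj.contMDiff.contMDiffAt.comp (ι y)
      (contMDiffAt_of_mem_maximalAtlas hχ haχ))
    simp only [Function.comp_apply, j, hw y haφ]
    exact contMDiffAt_symm_of_mem_maximalAtlas hφ (φ.map_source haφ)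
  · intro z hz
    simp [j, hw z hz, φ.left_inv hz]

/-- The topological embedding makes `f` continuous, so near `x` it stays where a local retraction
`ρ` inverts `ι`; there `f = ρ ∘ (ι ∘ f)`. -/
theorem Manifold.IsSmoothEmbedding.contMDiffWithinAt_of_comp {ι : N → Y}
    (hι : IsSmoothEmbedding (𝓡 k) (𝓡 n) ∞ ι) {f : X → N} {s : Set X} {x : X}
    (hf : ContMDiffWithinAt I (𝓡 n) ∞ (ι ∘ f) s x) : ContMDiffWithinAt I (𝓡 k) ∞ f s x := by
  have hc : ContinuousWithinAt f s x :=
    hι.isEmbedding.isInducing.continuousWithinAt_iff.2 hf.continuousWithinAt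
  obtain ⟨ρ, T, hT, hxT, hρ, hρT⟩ := hι.isImmersion.exists_local_retraction (f x)
  have h := ContMDiffAt.comp_contMDiffWithinAt (g := ρ) x hρ hf
  refine h.congr_of_eventuallyEq ?_ (hρT _ hxT).symm
  filter_upwards [hc (hT.mem_nhds hxT)] with p hp using (hρT _ hp).symm

theorem Manifold.IsSmoothEmbedding.contMDiffOn_iff_comp {ι : N → Y}
    (hι : IsSmoothEmbedding (𝓡 k) (𝓡 n) ∞ ι) {f : X → N} {s : Set X} :
    ContMDiffOn I (𝓡 k) ∞ f s ↔ ContMDiffOn I (𝓡 n) ∞ (ι ∘ f) s :=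
  ⟨fun h => hι.contMDiff.comp_contMDiffOn h, fun h x hx => hι.contMDiffWithinAt_of_comp (h x hx)⟩

end

/-! ### Embedded submanifolds as regular zero sets -/

namespace LieGpd

section

variable {n : ℕ} {X : Type*} [TopologicalSpace X] [ChartedSpace (EuclideanSpace ℝ (Fin n)) X]

/-- Near each of its points, `A` is the zero set of an `F`-valued smooth submersion. -/
def IsRegularZeroSet (n : ℕ) {X : Type*} [TopologicalSpace X]
    [ChartedSpace (EuclideanSpace ℝ (Fin n)) X] (F : Type*) [NormedAddCommGroup F]
    [NormedSpace ℝ F] (A : Set X) : Prop :=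
  ∀ a ∈ A, ∃ (W : Set X) (f : X → F), IsOpen W ∧ a ∈ W ∧ ContMDiffOn (𝓡 n) 𝓘(ℝ, F) ∞ f W ∧
    Function.Surjective (mfderiv (𝓡 n) 𝓘(ℝ, F) f a) ∧ ∀ p ∈ W, p ∈ A ↔ f p = 0

variable {F : Type*} [NormedAddCommGroup F] [NormedSpace ℝ F] {A : Set X} {k : ℕ}

/-- The chart of `A` induced by a chart `ψ` of the ambient manifold in which `A` is a linear
subspace. -/
noncomputable def sliceChart (ψ : OpenPartialHomeomorph X (EuclideanSpace ℝ (Fin n)))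
    (e : EuclideanSpace ℝ (Fin n) ≃L[ℝ] EuclideanSpace ℝ (Fin k) × F)
    (h : ∀ p ∈ ψ.source, p ∈ A ↔ (e (ψ p)).2 = 0) (a : A) :
    OpenPartialHomeomorph A (EuclideanSpace ℝ (Fin k)) where
  toFun p := (e (ψ p)).1
  -- Outside the target the inverse takes the dummy value `a`.
  invFun u := open Classical in
    if hu : e.symm (u, 0) ∈ ψ.target then ⟨ψ.symm (e.symm (u, 0)), (h _ (ψ.map_target hu)).2 (by
      rw [ψ.right_inv hu]; simp)⟩ else a
  source := Subtype.val ⁻¹' ψ.source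
  target := (fun u => e.symm (u, 0)) ⁻¹' ψ.target
  map_source' p hp := by
    have h1 : e.symm ((e (ψ p)).1, 0) = ψ p := by
      rw [← (h _ hp).1 p.2]; simp
    rw [mem_preimage, h1]
    exact ψ.map_source hp
  map_target' u hu := by
    rw [mem_preimage] at hu
    simp only [dif_pos hu, mem_preimage]
    exact ψ.map_target hu
  left_inv' p hp := by
    have h1 : e.symm ((e (ψ p)).1, 0) = ψ p := by
      rw [← (h _ hp).1 p.2]; simp
    have h2 : e.symm ((e (ψ p)).1, 0) ∈ ψ.target := by
      rw [h1]; exact ψ.map_source hp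
    rw [dif_pos h2]
    ext1
    simp only [h1, ψ.left_inv hp]
  right_inv' u hu := by
    rw [mem_preimage] at hu
    simp [dif_pos hu, ψ.right_inv hu]
  open_source := ψ.open_source.preimage continuous_subtype_val
  open_target := ψ.open_target.preimage (by fun_prop)
  continuousOn_toFun := by
    have h1 : ContinuousOn (fun p : A => ψ p) (Subtype.val ⁻¹' ψ.source) :=
      ψ.continuousOn.comp continuous_subtype_val.continuousOn (fun _ h => h)
    exact (continuous_fst.comp e.continuous).comp_continuousOn h1
  continuousOn_invFun := by
    rw [IsEmbedding.subtypeVal.isInducing.continuousOn_iff]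
    refine (ψ.continuousOn_symm.comp (f := fun u => e.symm (u, 0)) (by fun_prop)
      (fun _ h => h)).congr ?_
    intro u hu
    have hu' : e.symm (u, 0) ∈ ψ.target := hu
    simp [dif_pos hu']

omit [ChartedSpace (EuclideanSpace ℝ (Fin n)) X] in
theorem sliceChart_symm_coe (ψ : OpenPartialHomeomorph X (EuclideanSpace ℝ (Fin n)))
    (e : EuclideanSpace ℝ (Fin n) ≃L[ℝ] EuclideanSpace ℝ (Fin k) × F)
    (h : ∀ p ∈ ψ.source, p ∈ A ↔ (e (ψ p)).2 = 0) (a : A) {u : EuclideanSpace ℝ (Fin k)}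
    (hu : u ∈ (sliceChart ψ e h a).target) :
    ((sliceChart ψ e h a).symm u : X) = ψ.symm (e.symm (u, 0)) := by
  have hu' : e.symm (u, 0) ∈ ψ.target := hu
  exact congrArg Subtype.val (dif_pos hu')

variable [IsManifold (𝓡 n) ∞ X] [FiniteDimensional ℝ F]

/-- Adapted charts of the local defining functions flatten `A`. The induced charts change by
restrictions of the ambient changes of coordinates, and in them the inclusion reads `u ↦ (u, 0)`. -/
theorem IsRegularZeroSet.exists_embeddedSubmanifold (hA : IsRegularZeroSet n F A)
    (hk : Module.finrank ℝ F + k = n) :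
    ∃ S : EmbeddedSubmanifold n X, S.carrier = A ∧ S.dim = k := by
  have hch : ∀ a : A, ∃ ψ ∈ IsManifold.maximalAtlas (𝓡 n) ∞ X, (a : X) ∈ ψ.source ∧
      ∃ e : EuclideanSpace ℝ (Fin n) ≃L[ℝ] EuclideanSpace ℝ (Fin k) × F,
        ∀ p ∈ ψ.source, p ∈ A ↔ (e (ψ p)).2 = 0 := by
    intro a
    obtain ⟨W, f, hW, haW, hf, hs, hfA⟩ := hA a a.2
    obtain ⟨ψ, hψ, haψ, hψW, e, he⟩ := hf.exists_adapted_chart hk hW haW hs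
    exact ⟨ψ, hψ, haψ, e, fun p hp => by rw [he p hp, hfA p (hψW hp)]⟩
  choose ψ hψ haψ e he using hch
  let C : A → OpenPartialHomeomorph A (EuclideanSpace ℝ (Fin k)) :=
    fun a => sliceChart (ψ a) (e a) (he a) a
  let cs : ChartedSpace (EuclideanSpace ℝ (Fin k)) A :=
    { atlas := range C
      chartAt := C
      mem_chart_source := haψ
      chart_mem_atlas := fun a => mem_range_self a }
  have hm : IsManifold (𝓡 k) ∞ A := by
    apply isManifold_of_contDiffOn
    rintro _ _ ⟨a, rfl⟩ ⟨b, rfl⟩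
    have h1 : ContDiffOn ℝ ∞ ((ψ a).symm ≫ₕ ψ b) ((ψ a).symm ≫ₕ ψ b).source := by
      rw [← contMDiffOn_iff_contDiffOn]
      exact contMDiffOn_of_mem_contDiffGroupoid
        (IsManifold.compatible_of_mem_maximalAtlas (hψ a) (hψ b))
    have h2 : ∀ u ∈ ((C a).symm ≫ₕ C b).source,
        (e a).symm (u, 0) ∈ ((ψ a).symm ≫ₕ ψ b).source ∧
        ((C a).symm ≫ₕ C b) u = ((e b) (((ψ a).symm ≫ₕ ψ b) ((e a).symm (u, 0)))).1 := by
      intro u hu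
      rw [OpenPartialHomeomorph.trans_source] at hu ⊢
      have h3 := sliceChart_symm_coe (ψ a) (e a) (he a) a hu.1
      have h4 : ((C a).symm u : X) ∈ (ψ b).source := hu.2
      refine ⟨⟨hu.1, ?_⟩, ?_⟩
      · rw [mem_preimage, ← h3]; exact h4
      · change (e b (ψ b ((C a).symm u : X))).1 = _
        rw [h3]; rfl
    have h5 : ContDiff ℝ ∞ fun u : EuclideanSpace ℝ (Fin k) => (e a).symm (u, 0) :=
      (e a).symm.contDiff.comp (contDiff_id.prodMk contDiff_const)
    have h6 : ContDiffOn ℝ ∞ ((C a).symm ≫ₕ C b) ((C a).symm ≫ₕ C b).source :=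
      ((contDiff_fst.comp (e b).contDiff).comp_contDiffOn
        (h1.comp h5.contDiffOn fun u hu => (h2 u hu).1)).congr fun u hu => (h2 u hu).2
    simpa using h6
  refine ⟨⟨A, k, cs, hm, ?_, IsEmbedding.subtypeVal⟩, rfl, rfl⟩
  refine IsImmersionOfComplement.isImmersion (F := F) fun a => ?_
  refine IsImmersionAtOfComplement.mk_of_charts (e a).symm (C a) (ψ a) (haψ a) (haψ a)
    (IsManifold.chart_mem_maximalAtlas a) (hψ a) (fun _ h => h) ?_
  intro u hu
  have hu' : u ∈ (C a).target := by simpa using hu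
  have h3 := sliceChart_symm_coe (ψ a) (e a) (he a) a hu'
  change ψ a ((C a).symm u : X) = (e a).symm (u, 0)
  rw [h3]
  exact (ψ a).right_inv hu'

/-- A point of `A` supplies `finrank F ≤ n`, so `n - finrank F` is a genuine complementary
dimension. -/
theorem IsRegularZeroSet.exists_embeddedSubmanifold_of_nonempty
    (hA : IsRegularZeroSet n F A) (hne : A.Nonempty) :
    ∃ S : EmbeddedSubmanifold n X, S.carrier = A := by
  obtain ⟨a, ha⟩ := hne
  obtain ⟨W, f, -, -, -, hs, -⟩ := hA a ha
  obtain ⟨S, hS, -⟩ := hA.exists_embeddedSubmanifold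
    (Nat.add_sub_of_le (finrank_le_of_mfderiv_surjective hs))
  exact ⟨S, hS⟩

omit [IsManifold (𝓡 n) ∞ X] [FiniteDimensional ℝ F] in
-- In the charts of the immersion, `S` is where the complementary component vanishes. The complement
-- `K` is common to all points and is a factor of `ℝⁿ`, so it is finite-dimensional and gives a
-- single codimension.
theorem EmbeddedSubmanifold.exists_isRegularZeroSet (S : EmbeddedSubmanifold n X)
    (hS : S.carrier.Nonempty) :
    ∃ c : ℕ, c + S.dim = n ∧ IsRegularZeroSet n (EuclideanSpace ℝ (Fin c)) S.carrier := by
  obtain ⟨K, _, _, hK⟩ := S.isSmoothEmbedding.isImmersion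
  obtain ⟨a₀, ha₀⟩ := hS
  let e₀ := (hK ⟨a₀, ha₀⟩).equiv
  have hfin : FiniteDimensional ℝ (EuclideanSpace ℝ (Fin S.dim) × K) :=
    e₀.symm.toLinearEquiv.finiteDimensional
  have hfinK : FiniteDimensional ℝ K :=
    FiniteDimensional.of_surjective
      (LinearMap.snd ℝ (EuclideanSpace ℝ (Fin S.dim)) K) LinearMap.snd_surjective
  have hdim := e₀.toLinearEquiv.finrank_eq
  rw [Module.finrank_prod, finrank_euclideanSpace_fin, finrank_euclideanSpace_fin] at hdim
  let κ : K ≃L[ℝ] EuclideanSpace ℝ (Fin (Module.finrank ℝ K)) :=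
    ContinuousLinearEquiv.ofFinrankEq (by rw [finrank_euclideanSpace_fin])
  refine ⟨Module.finrank ℝ K, by omega, fun a ha => ?_⟩
  have h := hK ⟨a, ha⟩
  obtain ⟨φ, χ, e, haφ, haχ, hχ, hsub, hw⟩ :
      ∃ (φ : OpenPartialHomeomorph S.carrier (EuclideanSpace ℝ (Fin S.dim)))
        (χ : OpenPartialHomeomorph X (EuclideanSpace ℝ (Fin n)))
        (e : (EuclideanSpace ℝ (Fin S.dim) × K) ≃L[ℝ] EuclideanSpace ℝ (Fin n)),
        ⟨a, ha⟩ ∈ φ.source ∧ a ∈ χ.source ∧ χ ∈ IsManifold.maximalAtlas (𝓡 n) ∞ X ∧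
        φ.source ⊆ Subtype.val ⁻¹' χ.source ∧
        EqOn ((χ.extend (𝓡 n)) ∘ Subtype.val ∘ (φ.extend (𝓡 S.dim)).symm) (e ∘ (·, 0))
          (φ.extend (𝓡 S.dim)).target :=
    ⟨h.domChart, h.codChart, h.equiv, h.mem_domChart_source, h.mem_codChart_source,
      h.codChart_mem_maximalAtlas, h.source_subset_preimage_source, h.writtenInCharts⟩
  replace hw : ∀ z ∈ φ.source, e.symm (χ z) = (φ z, 0) := by
    intro z hz
    have h : χ (φ.symm (φ z)) = e (φ z, 0) :=
      hw (show φ z ∈ (φ.extend (𝓡 S.dim)).target by simpa using φ.map_source hz)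
    rw [φ.left_inv hz] at h
    simp [h]
  obtain ⟨W₀, hW₀, hφW₀⟩ := isOpen_induced_iff.1 φ.open_source
  let j : EuclideanSpace ℝ (Fin n) → EuclideanSpace ℝ (Fin (Module.finrank ℝ K)) :=
    fun v => κ (e.symm v).2
  have hj : ContDiff ℝ ∞ j := κ.contDiff.comp (contDiff_snd.comp e.symm.contDiff)
  have hfat : ContMDiffAt (𝓡 n) 𝓘(ℝ, EuclideanSpace ℝ (Fin (Module.finrank ℝ K))) ∞
      (j ∘ χ) a :=
    hj.contMDiff.contMDiffAt.comp a (contMDiffAt_of_mem_maximalAtlas hχ haχ)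
  let i : EuclideanSpace ℝ (Fin (Module.finrank ℝ K)) → EuclideanSpace ℝ (Fin n) :=
    fun v => e ((e.symm (χ a)).1, κ.symm v)
  have hi : ContDiff ℝ ∞ i :=
    e.contDiff.comp (contDiff_const.prodMk κ.symm.contDiff)
  have hia : i (j (χ a)) = χ a := by simp [i, j]
  -- Two shrinkings: `W₀` excludes points of `S` outside the domain of `φ`, which is where the
  -- subspace topology enters; requiring the first component to lie in `φ.target` ensures that every
  -- zero comes from a point of `S`.
  refine ⟨(χ.source ∩ χ ⁻¹' (e.symm ⁻¹' (Prod.fst ⁻¹' φ.target))) ∩ W₀, j ∘ χ, ?_, ?_, ?_, ?_, ?_⟩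
  · refine (χ.isOpen_inter_preimage ?_).inter hW₀
    exact (φ.open_target.preimage continuous_fst).preimage e.symm.continuous
  · refine ⟨⟨haχ, ?_⟩, ?_⟩
    · simpa [hw _ haφ] using φ.map_source haφ
    · rw [← hφW₀] at haφ
      exact haφ
  · exact hj.contMDiff.comp_contMDiffOn
      ((contMDiffOn_of_mem_maximalAtlas hχ).mono fun p hp => hp.1.1)
  · refine mfderiv_surjective_of_section (σ := χ.symm ∘ i)
      (hfat.mdifferentiableAt (by simp)) ?_ ?_ ?_
    · refine ContMDiffAt.mdifferentiableAt (n := ∞) (ContMDiffAt.comp _ ?_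
        hi.contMDiff.contMDiffAt) (by simp)
      simp only [Function.comp_apply, hia]
      exact contMDiffAt_symm_of_mem_maximalAtlas hχ (χ.map_source haχ)
    · simp [hia, χ.left_inv haχ]
    · filter_upwards [hi.continuous.continuousAt.preimage_mem_nhds
        (χ.open_target.mem_nhds (by simpa [hia] using χ.map_source haχ))] with v hv
      have hv' : i v ∈ χ.target := hv
      simp [χ.right_inv hv', i, j]
  · rintro p ⟨⟨hpχ, hpφ⟩, hpW⟩
    constructor
    · intro hp
      have hz : (⟨p, hp⟩ : S.carrier) ∈ φ.source := by rw [← hφW₀]; exact hpW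
      have := hw _ hz
      simp only at this
      simp [j, this]
    · intro hp
      have h0 : (e.symm (χ p)).2 = 0 := by simpa [j] using hp
      have hz := φ.map_target hpφ
      have h1 := hw _ hz
      rw [φ.right_inv hpφ] at h1
      have h2 : χ (φ.symm (e.symm (χ p)).1) = χ p := by
        apply e.symm.injective
        rw [h1, ← h0]
      rw [← χ.injOn (hsub hz) hpχ h2]
      exact Subtype.coe_prop _

end

end LieGpd

/-! ### Tangent spaces of submanifolds and orbits -/

theorem mfderiv_prodMk_space_apply {E H X F F' : Type*} [NormedAddCommGroup E] [NormedSpace ℝ E]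
    [TopologicalSpace H] {I : ModelWithCorners ℝ E H} [TopologicalSpace X] [ChartedSpace H X]
    [NormedAddCommGroup F] [NormedSpace ℝ F] [NormedAddCommGroup F'] [NormedSpace ℝ F']
    {f : X → F} {g : X → F'} {a : X} (hf : MDifferentiableAt I 𝓘(ℝ, F) f a)
    (hg : MDifferentiableAt I 𝓘(ℝ, F') g a) (v : TangentSpace I a) :
    (mfderiv I 𝓘(ℝ, F × F') (fun x => (f x, g x)) a v : F × F') =
      (mfderiv I 𝓘(ℝ, F) f a v, mfderiv I 𝓘(ℝ, F') g a v) := by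
  have hfg : MDifferentiableAt I 𝓘(ℝ, F × F') (fun x => (f x, g x)) a := hf.prodMk_space hg
  have h1 := mfderiv_comp a (ContinuousLinearMap.fst ℝ F F').mdifferentiableAt hfg
  have h2 := mfderiv_comp a (ContinuousLinearMap.snd ℝ F F').mdifferentiableAt hfg
  rw [ContinuousLinearMap.mfderiv_eq] at h1 h2
  exact Prod.ext (congrArg (fun T => T v) h1).symm (congrArg (fun T => T v) h2).symm

namespace LieGpd

section

variable {n : ℕ} {X : Type*} [TopologicalSpace X] [ChartedSpace (EuclideanSpace ℝ (Fin n)) X]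

theorem EmbeddedSubmanifold.mfderiv_eq_zero_of_mem_tangent (S : EmbeddedSubmanifold n X)
    {F : Type*} [NormedAddCommGroup F] [NormedSpace ℝ F] {f : X → F} {W : Set X} {y : X}
    (hy : y ∈ S.carrier) (hW : IsOpen W) (hyW : y ∈ W)
    (hf : MDifferentiableAt (𝓡 n) 𝓘(ℝ, F) f y) (h0 : ∀ p ∈ W, p ∈ S.carrier → f p = 0)
    {v : TangentSpace (𝓡 n) y} (hv : v ∈ S.tangent ⟨y, hy⟩) :
    mfderiv (𝓡 n) 𝓘(ℝ, F) f y v = 0 := by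
  obtain ⟨w, rfl⟩ := hv
  have hι : MDifferentiableAt (𝓡 S.dim) (𝓡 n) (Subtype.val : S.carrier → X) ⟨y, hy⟩ :=
    (S.isSmoothEmbedding.contMDiff _).mdifferentiableAt (by simp)
  have h1 : (f ∘ Subtype.val : S.carrier → F) =ᶠ[𝓝 ⟨y, hy⟩] fun _ => 0 := by
    filter_upwards [(hW.preimage continuous_subtype_val).mem_nhds hyW] with p hp using h0 p hp p.2
  have h2 := h1.mfderiv_eq (I := 𝓡 S.dim) (I' := 𝓘(ℝ, F))
  rw [mfderiv_comp (x := (⟨y, hy⟩ : S.carrier)) hf hι, mfderiv_const] at h2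
  exact congrArg (fun T => T w) h2

end

variable {m n : ℕ} {G M : Type*}
    [TopologicalSpace G] [ChartedSpace (EuclideanSpace ℝ (Fin m)) G] [IsManifold (𝓡 m) ∞ G]
    [T2Space G] [SecondCountableTopology G]
    [TopologicalSpace M] [ChartedSpace (EuclideanSpace ℝ (Fin n)) M] [IsManifold (𝓡 n) ∞ M]
    [T2Space M] [SecondCountableTopology M] {𝒢 : Gpd G M}

theorem Gpd.inv_inv {G M : Type*} (𝒢 : Gpd G M) (g : G) : 𝒢.inv (𝒢.inv g) = g := by
  have h := 𝒢.mul_assoc (𝒢.inv (𝒢.inv g)) (𝒢.inv g) g (by simp [𝒢.src_inv, 𝒢.tgt_inv])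
    (𝒢.src_inv g)
  rw [𝒢.inv_mul, 𝒢.inv_mul, 𝒢.src_inv, 𝒢.one_mul] at h
  have h2 := 𝒢.mul_one (𝒢.inv (𝒢.inv g))
  rw [𝒢.src_inv, 𝒢.tgt_inv] at h2
  rw [← h2, ← h]

namespace IsLieGroupoid

theorem mfderiv_src_surjective (h𝒢 : IsLieGroupoid m n 𝒢) (g : G) :
    Function.Surjective (mfderiv (𝓡 m) (𝓡 n) 𝒢.src g) :=
  (h𝒢.src_submersion.isSubmersionAt g).mfderiv_surjective

theorem mfderiv_tgt_surjective (h𝒢 : IsLieGroupoid m n 𝒢) (g : G) :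
    Function.Surjective (mfderiv (𝓡 m) (𝓡 n) 𝒢.tgt g) :=
  (h𝒢.tgt_submersion.isSubmersionAt g).mfderiv_surjective

theorem src_smooth (h𝒢 : IsLieGroupoid m n 𝒢) : ContMDiff (𝓡 m) (𝓡 n) ∞ 𝒢.src :=
  h𝒢.src_submersion.contMDiff

theorem tgt_smooth (h𝒢 : IsLieGroupoid m n 𝒢) : ContMDiff (𝓡 m) (𝓡 n) ∞ 𝒢.tgt :=
  h𝒢.tgt_submersion.contMDiff

theorem mdifferentiableAt_src (h𝒢 : IsLieGroupoid m n 𝒢) (g : G) :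
    MDifferentiableAt (𝓡 m) (𝓡 n) 𝒢.src g := (h𝒢.src_smooth g).mdifferentiableAt (by simp)

theorem mdifferentiableAt_tgt (h𝒢 : IsLieGroupoid m n 𝒢) (g : G) :
    MDifferentiableAt (𝓡 m) (𝓡 n) 𝒢.tgt g := (h𝒢.tgt_smooth g).mdifferentiableAt (by simp)

/-- Right translation by `g` carries `ker d(src)` at the unit to `ker d(src)` at `g`. -/
theorem exists_mfderiv_tgt_eq (h𝒢 : IsLieGroupoid m n 𝒢) (g : G)
    {b : TangentSpace (𝓡 n) (𝒢.tgt g)} (hb : b ∈ 𝒢.orbitTangent m n (𝒢.tgt g)) :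
    ∃ ξ : TangentSpace (𝓡 m) g, mfderiv (𝓡 m) (𝓡 n) 𝒢.src g ξ = 0 ∧
      mfderiv (𝓡 m) (𝓡 n) 𝒢.tgt g ξ = b := by
  obtain ⟨η, hη, hηb⟩ := hb
  have hη' : mfderiv (𝓡 m) (𝓡 n) 𝒢.src (𝒢.one (𝒢.tgt g)) η = 0 := hη
  let u := 𝒢.one (𝒢.tgt g)
  let χ := chartAt (EuclideanSpace ℝ (Fin n)) (𝒢.src u)
  have huχ : 𝒢.src u ∈ χ.source := mem_chart_source _ _
  have hχ : χ ∈ IsManifold.maximalAtlas (𝓡 n) ∞ M := IsManifold.chart_mem_maximalAtlas _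
  have hχd : MDifferentiableAt (𝓡 n) (𝓡 n) χ (𝒢.src u) :=
    (contMDiffAt_of_mem_maximalAtlas hχ huχ).mdifferentiableAt (by simp)
  have hf : ContMDiffOn (𝓡 m) 𝓘(ℝ, EuclideanSpace ℝ (Fin n)) ∞ (χ ∘ 𝒢.src)
      (𝒢.src ⁻¹' χ.source) :=
    (contMDiffOn_of_mem_maximalAtlas hχ).comp h𝒢.src_smooth.contMDiffOn (fun _ h => h)
  have hcomp := mfderiv_comp u hχd (h𝒢.mdifferentiableAt_src u)
  obtain ⟨c, O, hO, h0, hc, hc0, hcf, hcd⟩ := hf.exists_curve_in_fiber (a := u)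
    (χ.open_source.preimage h𝒢.src_smooth.continuous) huχ
    (by
      rw [hcomp]
      exact Function.Surjective.comp (g := mfderiv (𝓡 n) (𝓡 n) χ (𝒢.src u))
        (mfderiv_chart_surjective hχ huχ) (h𝒢.mfderiv_src_surjective u)) η
    (by
      rw [hcomp]
      exact (congrArg (mfderiv (𝓡 n) (𝓡 n) χ (𝒢.src u)) hη').trans (map_zero _))
  have hsc : ∀ r ∈ O, 𝒢.src (c r) = 𝒢.tgt g := by
    intro r hr
    rw [χ.injOn (hcf r hr).1 huχ (hcf r hr).2, 𝒢.src_one]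
  -- Right translation by `g` makes sense only on a source fibre, so its effect on `η` is read off a
  -- curve in that fibre with velocity `η`: along `γ` the source is constant and the target is that
  -- of `c`.
  let γ : ℝ → G := fun r => 𝒢.mul (c r) g
  have hγ : ContMDiffOn 𝓘(ℝ, ℝ) (𝓡 m) ∞ γ O :=
    h𝒢.mul_smooth.comp (f := fun r => (c r, g)) (hc.prodMk contMDiffOn_const) hsc
  have hγ0 : γ 0 = g := by
    simp only [γ, hc0, u, 𝒢.one_mul]
  have hγd : MDifferentiableAt 𝓘(ℝ, ℝ) (𝓡 m) γ 0 :=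
    (hγ.contMDiffAt (hO.mem_nhds h0)).mdifferentiableAt (by simp)
  have hcd' : MDifferentiableAt 𝓘(ℝ, ℝ) (𝓡 m) c 0 :=
    (hc.contMDiffAt (hO.mem_nhds h0)).mdifferentiableAt (by simp)
  have h1 : 𝒢.src ∘ γ =ᶠ[𝓝 0] fun _ => 𝒢.src g := by
    filter_upwards [hO.mem_nhds h0] with r hr using 𝒢.src_mul _ _ (hsc r hr)
  have h2 : 𝒢.tgt ∘ γ =ᶠ[𝓝 0] 𝒢.tgt ∘ c := by
    filter_upwards [hO.mem_nhds h0] with r hr using 𝒢.tgt_mul _ _ (hsc r hr)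
  have h1' := h1.mfderiv_eq (I := 𝓘(ℝ, ℝ)) (I' := 𝓡 n)
  have h2' := h2.mfderiv_eq (I := 𝓘(ℝ, ℝ)) (I' := 𝓡 n)
  rw [mfderiv_comp 0 (h𝒢.mdifferentiableAt_src _) hγd, mfderiv_const, hγ0] at h1'
  rw [mfderiv_comp 0 (h𝒢.mdifferentiableAt_tgt _) hγd,
    mfderiv_comp 0 (h𝒢.mdifferentiableAt_tgt _) hcd', hγ0, hc0] at h2'
  refine ⟨mfderiv 𝓘(ℝ, ℝ) (𝓡 m) γ 0 (1 : ℝ), ?_, ?_⟩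
  · exact congrArg (fun T => T (1 : ℝ)) h1'
  · refine (congrArg (fun T => T (1 : ℝ)) h2').trans (Eq.trans ?_ hηb)
    exact congrArg (mfderiv (𝓡 m) (𝓡 n) 𝒢.tgt u) hcd

end IsLieGroupoid
end LieGpd

/-! ### Consequences of transversality -/

namespace LieGpd

variable {m n : ℕ} {G M : Type*}
    [TopologicalSpace G] [ChartedSpace (EuclideanSpace ℝ (Fin m)) G] [IsManifold (𝓡 m) ∞ G]
    [T2Space G] [SecondCountableTopology G]
    [TopologicalSpace M] [ChartedSpace (EuclideanSpace ℝ (Fin n)) M] [IsManifold (𝓡 n) ∞ M]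
    [T2Space M] [SecondCountableTopology M] {𝒢 : Gpd G M} {S : EmbeddedSubmanifold n M}
    {F : Type*} [NormedAddCommGroup F] [NormedSpace ℝ F]

namespace IsLieGroupoid

/-- If `S` is transversal to the orbits and `f` is a local defining function of `S` near the target
of `g`, then `(d src, d (f ∘ tgt))` is surjective at `g`. -/
theorem exists_mfderiv_src_eq_and_mfderiv_comp_tgt_eq (h𝒢 : IsLieGroupoid m n 𝒢)
    (hS : ∀ y : S.carrier, S.tangent y ⊔ 𝒢.orbitTangent m n (y : M) = ⊤)
    {g : G} (hg : 𝒢.tgt g ∈ S.carrier) {f : M → F} {W : Set M} (hW : IsOpen W)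
    (hgW : 𝒢.tgt g ∈ W) (hf : ContMDiffOn (𝓡 n) 𝓘(ℝ, F) ∞ f W)
    (hs : Function.Surjective (mfderiv (𝓡 n) 𝓘(ℝ, F) f (𝒢.tgt g)))
    (hfS : ∀ p ∈ W, p ∈ S.carrier ↔ f p = 0) (v : TangentSpace (𝓡 n) (𝒢.src g)) (w : F) :
    ∃ ξ : TangentSpace (𝓡 m) g, mfderiv (𝓡 m) (𝓡 n) 𝒢.src g ξ = v ∧
      mfderiv (𝓡 m) 𝓘(ℝ, F) (f ∘ 𝒢.tgt) g ξ = w := by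
  have hfd : MDifferentiableAt (𝓡 n) 𝓘(ℝ, F) f (𝒢.tgt g) :=
    (hf.contMDiffAt (hW.mem_nhds hgW)).mdifferentiableAt (by simp)
  rw [mfderiv_comp g hfd (h𝒢.mdifferentiableAt_tgt g)]
  -- Any lift `ξ₀` of `v` misses `w` by `w - w₀`. A preimage `q` of this error splits as `a + b`
  -- with `a` tangent to `S`, hence killed by `df`, and `b` tangent to the orbit; lifting `b` into
  -- `ker d(src)` corrects `ξ₀` without disturbing `v`.
  obtain ⟨ξ₀, hξ₀⟩ := h𝒢.mfderiv_src_surjective g v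
  let w₀ : F := mfderiv (𝓡 n) 𝓘(ℝ, F) f (𝒢.tgt g) (mfderiv (𝓡 m) (𝓡 n) 𝒢.tgt g ξ₀)
  obtain ⟨q, hq⟩ := hs (w - w₀ : F)
  have hqmem : q ∈ S.tangent ⟨𝒢.tgt g, hg⟩ ⊔ 𝒢.orbitTangent m n (𝒢.tgt g) := by
    rw [hS ⟨𝒢.tgt g, hg⟩]; trivial
  obtain ⟨a, ha, b, hb, rfl⟩ := Submodule.mem_sup.1 hqmem
  obtain ⟨ξ₁, h1, h2⟩ := h𝒢.exists_mfderiv_tgt_eq g hb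
  have ha0 := S.mfderiv_eq_zero_of_mem_tangent hg hW hgW hfd (fun p hp => (hfS p hp).1) ha
  refine ⟨ξ₀ + ξ₁, ?_, ?_⟩
  · rw [map_add, h1, hξ₀, add_zero]
  · change mfderiv (𝓡 n) 𝓘(ℝ, F) f (𝒢.tgt g) (mfderiv (𝓡 m) (𝓡 n) 𝒢.tgt g (ξ₀ + ξ₁)) = w
    rw [map_add, h2, map_add]
    rw [map_add, ha0, zero_add] at hq
    rw [hq]
    exact add_sub_cancel w₀ w

/-- Near an arrow whose target lies in a transversal `S`, the source map has smooth local sections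
consisting of arrows with target in `S`. -/
theorem exists_section_src (h𝒢 : IsLieGroupoid m n 𝒢)
    (hS : ∀ y : S.carrier, S.tangent y ⊔ 𝒢.orbitTangent m n (y : M) = ⊤)
    {g : G} (hg : 𝒢.tgt g ∈ S.carrier) :
    ∃ (τ : M → G) (O : Set M), IsOpen O ∧ 𝒢.src g ∈ O ∧ ContMDiffOn (𝓡 n) (𝓡 m) ∞ τ O ∧
      τ (𝒢.src g) = g ∧ ∀ y ∈ O, 𝒢.src (τ y) = y ∧ 𝒢.tgt (τ y) ∈ S.carrier := by
  obtain ⟨c, -, hreg⟩ := S.exists_isRegularZeroSet ⟨_, hg⟩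
  obtain ⟨W, f, hW, hgW, hf, hs, hfS⟩ := hreg _ hg
  let χ := chartAt (EuclideanSpace ℝ (Fin n)) (𝒢.src g)
  have hgχ : 𝒢.src g ∈ χ.source := mem_chart_source _ _
  have hχ : χ ∈ IsManifold.maximalAtlas (𝓡 n) ∞ M := IsManifold.chart_mem_maximalAtlas _
  have hχd : MDifferentiableAt (𝓡 n) (𝓡 n) χ (𝒢.src g) :=
    (contMDiffAt_of_mem_maximalAtlas hχ hgχ).mdifferentiableAt (by simp)
  have hfd : MDifferentiableAt (𝓡 n) (𝓡 c) f (𝒢.tgt g) :=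
    (hf.contMDiffAt (hW.mem_nhds hgW)).mdifferentiableAt (by simp)
  let Ψ : G → EuclideanSpace ℝ (Fin n) × EuclideanSpace ℝ (Fin c) :=
    fun h => ((χ ∘ 𝒢.src) h, (f ∘ 𝒢.tgt) h)
  have hΨ : ContMDiffOn (𝓡 m) 𝓘(ℝ, EuclideanSpace ℝ (Fin n) × EuclideanSpace ℝ (Fin c)) ∞ Ψ
      (𝒢.src ⁻¹' χ.source ∩ 𝒢.tgt ⁻¹' W) := by
    refine ContMDiffOn.prodMk_space ?_ ?_
    · exact (contMDiffOn_of_mem_maximalAtlas hχ).comp h𝒢.src_smooth.contMDiffOn fun _ h => h.1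
    · exact hf.comp h𝒢.tgt_smooth.contMDiffOn fun _ h => h.2
  obtain ⟨σ, O, hO, hgO, hσ, hσg, hσΨ⟩ := hΨ.exists_local_section
    ((χ.open_source.preimage h𝒢.src_smooth.continuous).inter
      (hW.preimage h𝒢.tgt_smooth.continuous)) ⟨hgχ, hgW⟩ (by
    rintro ⟨v, w⟩
    obtain ⟨v', hv'⟩ := mfderiv_chart_surjective hχ hgχ v
    obtain ⟨ξ, h1, h2⟩ :=
      h𝒢.exists_mfderiv_src_eq_and_mfderiv_comp_tgt_eq hS hg hW hgW hf hs hfS v' w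
    refine ⟨ξ, (mfderiv_prodMk_space_apply (hχd.comp g (h𝒢.mdifferentiableAt_src g))
      (hfd.comp g (h𝒢.mdifferentiableAt_tgt g)) ξ).trans (Prod.ext ?_ h2)⟩
    rw [mfderiv_comp g hχd (h𝒢.mdifferentiableAt_src g)]
    exact (congrArg (mfderiv (𝓡 n) (𝓡 n) χ (𝒢.src g)) h1).trans hv')
  -- Restricting the section of `Ψ` to second component zero forces the targets into `S`.
  let i : EuclideanSpace ℝ (Fin n) → EuclideanSpace ℝ (Fin n) × EuclideanSpace ℝ (Fin c) :=
    fun v => (v, 0)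
  have hi : ContDiff ℝ ∞ i := contDiff_id.prodMk contDiff_const
  have hig : i (χ (𝒢.src g)) = Ψ g := by
    simp [i, Ψ, (hfS _ hgW).1 hg]
  refine ⟨σ ∘ i ∘ χ, χ.source ∩ χ ⁻¹' (i ⁻¹' O), χ.isOpen_inter_preimage
    (hO.preimage hi.continuous), ⟨hgχ, by simpa [hig] using hgO⟩, ?_, by simp [hig, hσg], ?_⟩
  · exact hσ.comp (hi.contMDiff.comp_contMDiffOn
      ((contMDiffOn_of_mem_maximalAtlas hχ).mono inter_subset_left)) fun y hy => hy.2
  · rintro y ⟨hyχ, hyO⟩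
    obtain ⟨⟨h1, h2⟩, h3⟩ := hσΨ _ hyO
    have h4 : χ (𝒢.src (σ (i (χ y)))) = χ y := congrArg Prod.fst h3
    have h5 : f (𝒢.tgt (σ (i (χ y)))) = 0 := congrArg Prod.snd h3
    exact ⟨χ.injOn h1 hyχ h4, (hfS _ h2).2 h5⟩

theorem isRegularZeroSet_preimage_tgt (h𝒢 : IsLieGroupoid m n 𝒢) {B : Set M}
    (hB : IsRegularZeroSet n F B) : IsRegularZeroSet m F (𝒢.tgt ⁻¹' B) := by
  intro g hg
  obtain ⟨W, f, hW, hgW, hf, hs, hfB⟩ := hB _ hg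
  have hfd : MDifferentiableAt (𝓡 n) 𝓘(ℝ, F) f (𝒢.tgt g) :=
    (hf.contMDiffAt (hW.mem_nhds hgW)).mdifferentiableAt (by simp)
  refine ⟨𝒢.tgt ⁻¹' W, f ∘ 𝒢.tgt, hW.preimage h𝒢.tgt_smooth.continuous, hgW,
    hf.comp h𝒢.tgt_smooth.contMDiffOn fun _ h => h, ?_, fun p hp => hfB _ hp⟩
  rw [mfderiv_comp g hfd (h𝒢.mdifferentiableAt_tgt g)]
  exact Function.Surjective.comp (g := mfderiv (𝓡 n) 𝓘(ℝ, F) f (𝒢.tgt g)) hs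
    (h𝒢.mfderiv_tgt_surjective g)

/-- The two conditions are cut out by `(f₁ ∘ src, f₂ ∘ tgt)`. They are independent because `d src`
and `d(f₂ ∘ tgt)` can be prescribed simultaneously. -/
theorem isRegularZeroSet_restrict (h𝒢 : IsLieGroupoid m n 𝒢)
    (hS : ∀ y : S.carrier, S.tangent y ⊔ 𝒢.orbitTangent m n (y : M) = ⊤)
    (hF : IsRegularZeroSet n F S.carrier) :
    IsRegularZeroSet m (F × F) {g | 𝒢.src g ∈ S.carrier ∧ 𝒢.tgt g ∈ S.carrier} := by
  rintro g ⟨hgs, hgt⟩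
  obtain ⟨W₁, f₁, hW₁, hgW₁, hf₁, hs₁, hfS₁⟩ := hF _ hgs
  obtain ⟨W₂, f₂, hW₂, hgW₂, hf₂, hs₂, hfS₂⟩ := hF _ hgt
  have hfd₁ : MDifferentiableAt (𝓡 n) 𝓘(ℝ, F) f₁ (𝒢.src g) :=
    (hf₁.contMDiffAt (hW₁.mem_nhds hgW₁)).mdifferentiableAt (by simp)
  have hfd₂ : MDifferentiableAt (𝓡 n) 𝓘(ℝ, F) f₂ (𝒢.tgt g) :=
    (hf₂.contMDiffAt (hW₂.mem_nhds hgW₂)).mdifferentiableAt (by simp)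
  refine ⟨𝒢.src ⁻¹' W₁ ∩ 𝒢.tgt ⁻¹' W₂, fun h => ((f₁ ∘ 𝒢.src) h, (f₂ ∘ 𝒢.tgt) h),
    (hW₁.preimage h𝒢.src_smooth.continuous).inter (hW₂.preimage h𝒢.tgt_smooth.continuous),
    ⟨hgW₁, hgW₂⟩, ?_, ?_, ?_⟩
  · refine ContMDiffOn.prodMk_space ?_ ?_
    · exact hf₁.comp h𝒢.src_smooth.contMDiffOn fun _ h => h.1
    · exact hf₂.comp h𝒢.tgt_smooth.contMDiffOn fun _ h => h.2
  · rintro ⟨v, w⟩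
    obtain ⟨v', hv'⟩ := hs₁ v
    obtain ⟨ξ, h1, h2⟩ :=
      h𝒢.exists_mfderiv_src_eq_and_mfderiv_comp_tgt_eq hS hgt hW₂ hgW₂ hf₂ hs₂ hfS₂ v' w
    refine ⟨ξ, (mfderiv_prodMk_space_apply (hfd₁.comp g (h𝒢.mdifferentiableAt_src g))
      (hfd₂.comp g (h𝒢.mdifferentiableAt_tgt g)) ξ).trans (Prod.ext ?_ h2)⟩
    rw [mfderiv_comp g hfd₁ (h𝒢.mdifferentiableAt_src g)]
    exact (congrArg (mfderiv (𝓡 n) 𝓘(ℝ, F) f₁ (𝒢.src g)) h1).trans hv'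
  · rintro p ⟨hp1, hp2⟩
    rw [mem_ofPred_eq, hfS₁ _ hp1, hfS₂ _ hp2]
    simp

theorem exists_embeddedSubmanifold_restrict (h𝒢 : IsLieGroupoid m n 𝒢)
    (hS : ∀ y : S.carrier, S.tangent y ⊔ 𝒢.orbitTangent m n (y : M) = ⊤)
    (hne : S.carrier.Nonempty) :
    ∃ A : EmbeddedSubmanifold m G,
      ∀ g, g ∈ A.carrier ↔ 𝒢.src g ∈ S.carrier ∧ 𝒢.tgt g ∈ S.carrier := by
  obtain ⟨c, -, hreg⟩ := S.exists_isRegularZeroSet hne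
  obtain ⟨y, hy⟩ := hne
  obtain ⟨A, hA⟩ :=
    (h𝒢.isRegularZeroSet_restrict hS hreg).exists_embeddedSubmanifold_of_nonempty
      ⟨𝒢.one y, by rw [mem_ofPred_eq, 𝒢.src_one, 𝒢.tgt_one]; exact ⟨hy, hy⟩⟩
  exact ⟨A, fun g => by rw [hA]; rfl⟩

theorem exists_embeddedSubmanifold_preimage_tgt (h𝒢 : IsLieGroupoid m n 𝒢)
    (hne : S.carrier.Nonempty) :
    ∃ P : EmbeddedSubmanifold m G, ∀ g, g ∈ P.carrier ↔ 𝒢.tgt g ∈ S.carrier := by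
  obtain ⟨c, -, hreg⟩ := S.exists_isRegularZeroSet hne
  obtain ⟨y, hy⟩ := hne
  obtain ⟨P, hP⟩ :=
    (h𝒢.isRegularZeroSet_preimage_tgt hreg).exists_embeddedSubmanifold_of_nonempty
      ⟨𝒢.one y, by rw [mem_preimage, 𝒢.tgt_one]; exact hy⟩
  exact ⟨P, fun g => by rw [hP]; rfl⟩

end IsLieGroupoid

end LieGpd

/-! ### Restrictions of Lie groupoids -/

namespace LieGpd

theorem Gpd.coe_restrict_mul {G M : Type*} (𝒢 : Gpd G M) {A : G → Prop} {B : M → Prop}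
    (hA : ∀ g, A g ↔ B (𝒢.src g) ∧ B (𝒢.tgt g)) {g h : {g // A g}}
    (c : 𝒢.src g = 𝒢.tgt h) : ((𝒢.restrict hA).mul g h : G) = 𝒢.mul g h := by
  simp [Gpd.restrict, c]

variable {m n : ℕ} {G M : Type*}
    [TopologicalSpace G] [ChartedSpace (EuclideanSpace ℝ (Fin m)) G]
    [TopologicalSpace M] [ChartedSpace (EuclideanSpace ℝ (Fin n)) M]

/-- A smooth map between embedded subsets is a submersion if it is locally split by smooth maps of
the ambient manifolds. -/
theorem isSubmersion_of_exists_section {k l : ℕ} {A : G → Prop} {B : M → Prop}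
    [ChartedSpace (EuclideanSpace ℝ (Fin k)) {g // A g}] [IsManifold (𝓡 k) ∞ {g // A g}]
    [ChartedSpace (EuclideanSpace ℝ (Fin l)) {y // B y}] [IsManifold (𝓡 l) ∞ {y // B y}]
    (hιA : IsSmoothEmbedding (𝓡 k) (𝓡 m) ∞ (Subtype.val : {g // A g} → G))
    (hιB : IsSmoothEmbedding (𝓡 l) (𝓡 n) ∞ (Subtype.val : {y // B y} → M))
    {f : {g // A g} → {y // B y}} {f' : G → M} (hf' : ContMDiff (𝓡 m) (𝓡 n) ∞ f')
    (hff' : ∀ g, (f g : M) = f' g)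
    (hsec : ∀ g : {g // A g}, ∃ (τ : M → G) (O : Set M), IsOpen O ∧ f' g ∈ O ∧
      ContMDiffOn (𝓡 n) (𝓡 m) ∞ τ O ∧ τ (f' g) = g ∧
      ∀ y ∈ O, f' (τ y) = y ∧ (B y → A (τ y))) :
    IsSubmersion (𝓡 k) (𝓡 l) ∞ f := by
  classical
  have hf : ContMDiff (𝓡 k) (𝓡 l) ∞ f := by
    rw [← contMDiffOn_univ, hιB.contMDiffOn_iff_comp]
    exact (hf'.comp hιA.contMDiff).contMDiffOn.congr fun g _ => hff' g
  refine hf.isSubmersion_of_mfderiv_surjective fun a => ?_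
  obtain ⟨τ, O, hO, haO, hτ, hτa, hτO⟩ := hsec a
  have hOa : {y : {y // B y} | (y : M) ∈ O} ∈ 𝓝 (f a) :=
    (hO.preimage continuous_subtype_val).mem_nhds (by rwa [mem_preimage, hff'])
  -- The default `a` can occur only off `O`; the germ of `σ` at `f a` is that of `τ`.
  let σ : {y // B y} → {g // A g} := fun y => if h : A (τ y) then ⟨τ y, h⟩ else a
  have hσ : ∀ y : {y // B y}, (y : M) ∈ O → (σ y : G) = τ y := by
    intro y hy
    simp [σ, (hτO y hy).2 y.2]
  refine mfderiv_surjective_of_section (σ := σ) ((hf a).mdifferentiableAt (by simp)) ?_ ?_ ?_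
  · refine ContMDiffAt.mdifferentiableAt (n := ∞) ?_ (by simp)
    rw [← contMDiffWithinAt_univ]
    refine hιA.contMDiffWithinAt_of_comp ?_
    rw [contMDiffWithinAt_univ]
    have h1 : ContMDiffAt (𝓡 l) (𝓡 m) ∞ (τ ∘ Subtype.val) (f a) := by
      refine ContMDiffAt.comp _ ?_ hιB.contMDiff.contMDiffAt
      rw [hff']
      exact hτ.contMDiffAt (hO.mem_nhds haO)
    refine h1.congr_of_eventuallyEq ?_
    filter_upwards [hOa] with y hy using hσ y hy
  · ext1
    rw [hσ _ (by rwa [hff']), hff', hτa]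
  · filter_upwards [hOa] with y hy
    ext1
    rw [hff', hσ y hy, (hτO y hy).1]

variable [IsManifold (𝓡 m) ∞ G] [T2Space G] [SecondCountableTopology G]
    [IsManifold (𝓡 n) ∞ M] [T2Space M] [SecondCountableTopology M] {𝒢 : Gpd G M}

namespace IsLieGroupoid

/-- Smoothness of the structure maps is inherited through the embeddings. Submersivity is not, and
`hsec` provides it; one form of `hsec` covers both the slice and the open saturation. -/
theorem restrict (h𝒢 : IsLieGroupoid m n 𝒢) {k l : ℕ} {A : G → Prop} {B : M → Prop}
    (hA : ∀ g, A g ↔ B (𝒢.src g) ∧ B (𝒢.tgt g))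
    [ChartedSpace (EuclideanSpace ℝ (Fin k)) {g // A g}] [IsManifold (𝓡 k) ∞ {g // A g}]
    [SecondCountableTopology {g // A g}]
    [ChartedSpace (EuclideanSpace ℝ (Fin l)) {y // B y}] [IsManifold (𝓡 l) ∞ {y // B y}]
    [SecondCountableTopology {y // B y}]
    (hιA : IsSmoothEmbedding (𝓡 k) (𝓡 m) ∞ (Subtype.val : {g // A g} → G))
    (hιB : IsSmoothEmbedding (𝓡 l) (𝓡 n) ∞ (Subtype.val : {y // B y} → M))
    (hsec : ∀ g, A g → ∃ (τ : M → G) (O : Set M), IsOpen O ∧ 𝒢.src g ∈ O ∧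
      ContMDiffOn (𝓡 n) (𝓡 m) ∞ τ O ∧ τ (𝒢.src g) = g ∧
      ∀ y ∈ O, 𝒢.src (τ y) = y ∧ (B y → A (τ y))) :
    IsLieGroupoid k l (𝒢.restrict hA) where
  src_submersion := isSubmersion_of_exists_section hιA hιB h𝒢.src_smooth (fun _ => rfl)
    fun g => hsec g g.2
  tgt_submersion := by
    refine isSubmersion_of_exists_section hιA hιB h𝒢.tgt_smooth (fun _ => rfl) fun g => ?_
    have hinv : ∀ g, A g → A (𝒢.inv g) := fun g hg => by
      rw [hA, 𝒢.src_inv, 𝒢.tgt_inv]; exact ((hA g).1 hg).symm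
    -- Inverting a section of `src` through `g⁻¹` gives a section of `tgt` through `g`.
    obtain ⟨τ, O, hO, hgO, hτ, hτg, hτO⟩ := hsec (𝒢.inv g) (hinv g g.2)
    rw [𝒢.src_inv] at hgO hτg
    refine ⟨𝒢.inv ∘ τ, O, hO, hgO, h𝒢.inv_smooth.comp_contMDiffOn hτ, ?_, fun y hy => ⟨?_, ?_⟩⟩
    · rw [Function.comp_apply, hτg, 𝒢.inv_inv]
    · rw [Function.comp_apply, 𝒢.tgt_inv, (hτO y hy).1]
    · exact fun h => hinv _ ((hτO y hy).2 h)
  mul_smooth := by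
    rw [hιA.contMDiffOn_iff_comp]
    refine ContMDiffOn.congr (f := fun p : {g // A g} × {g // A g} => 𝒢.mul p.1 p.2)
      (h𝒢.mul_smooth.comp (f := fun p : {g // A g} × {g // A g} => ((p.1 : G), (p.2 : G)))
        ((hιA.contMDiff.comp contMDiff_fst).prodMk
          (hιA.contMDiff.comp contMDiff_snd)).contMDiffOn
        fun p hp => congrArg Subtype.val hp)
      fun p hp => 𝒢.coe_restrict_mul hA (congrArg Subtype.val hp)
  one_smooth := by
    rw [← contMDiffOn_univ, hιA.contMDiffOn_iff_comp]
    exact (h𝒢.one_smooth.comp hιB.contMDiff).contMDiffOn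
  inv_smooth := by
    rw [← contMDiffOn_univ, hιA.contMDiffOn_iff_comp]
    exact (h𝒢.inv_smooth.comp hιA.contMDiff).contMDiffOn

end IsLieGroupoid

end LieGpd

/-! ### The principal bibundle -/

namespace LieGpd

namespace Gpd

variable {G M : Type*} (𝒢 : Gpd G M)

theorem mul_mul_inv {g h : G} (c : 𝒢.src g = 𝒢.tgt h) : 𝒢.mul (𝒢.mul g h) (𝒢.inv h) = g := by
  rw [𝒢.mul_assoc _ _ _ c (𝒢.tgt_inv h).symm, 𝒢.mul_inv, ← c, 𝒢.mul_one]

theorem mul_inv_mul {g h : G} (c : 𝒢.src g = 𝒢.src h) : 𝒢.mul (𝒢.mul g (𝒢.inv h)) h = g := by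
  rw [𝒢.mul_assoc _ _ _ (c.trans (𝒢.tgt_inv h).symm) (𝒢.src_inv h), 𝒢.inv_mul, ← c, 𝒢.mul_one]

theorem inv_mul_mul {g h : G} (c : 𝒢.src g = 𝒢.tgt h) : 𝒢.mul (𝒢.inv g) (𝒢.mul g h) = h := by
  rw [← 𝒢.mul_assoc _ _ _ (𝒢.src_inv g) c, 𝒢.inv_mul, c, 𝒢.one_mul]

theorem mul_mul_inv_mul {g h : G} (c : 𝒢.tgt g = 𝒢.tgt h) :
    𝒢.mul g (𝒢.mul (𝒢.inv g) h) = h := by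
  rw [← 𝒢.mul_assoc _ _ _ (𝒢.tgt_inv g).symm ((𝒢.src_inv g).trans c), 𝒢.mul_inv, c, 𝒢.one_mul]

end Gpd

open Classical in
/-- The element `x` of the subtype `A` if it belongs to it, and `a` otherwise. -/
noncomputable def liftOr {X : Type*} {A : X → Prop} (x : X) (a : {x // A x}) : {x // A x} :=
  if h : A x then ⟨x, h⟩ else a

theorem coe_liftOr {X : Type*} {A : X → Prop} {x : X} (h : A x) (a : {x // A x}) :
    (liftOr x a : X) = x := by
  rw [liftOr, dif_pos h]

/-- Actions and divisions are made total by default values; on the set where they are meaningful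
these do not occur, so smoothness can be checked in the ambient manifold. -/
theorem contMDiffOn_liftOr {E H Y : Type*} [NormedAddCommGroup E] [NormedSpace ℝ E]
    [TopologicalSpace H] {I : ModelWithCorners ℝ E H} [TopologicalSpace Y] [ChartedSpace H Y]
    {k n : ℕ} {X : Type*} [TopologicalSpace X] [ChartedSpace (EuclideanSpace ℝ (Fin n)) X]
    {A : X → Prop} [ChartedSpace (EuclideanSpace ℝ (Fin k)) {x // A x}]
    (hιA : IsSmoothEmbedding (𝓡 k) (𝓡 n) ∞ (Subtype.val : {x // A x} → X)) {f : Y → X}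
    {d : Y → {x // A x}} {s : Set Y} (hf : ContMDiffOn I (𝓡 n) ∞ f s)
    (hs : ∀ y ∈ s, A (f y)) : ContMDiffOn I (𝓡 k) ∞ (fun y => liftOr (f y) (d y)) s := by
  rw [hιA.contMDiffOn_iff_comp]
  exact hf.congr fun y hy => coe_liftOr (hs y hy) _

universe u v

variable {m n : ℕ} {G : Type v} {M : Type u}
    [TopologicalSpace G] [ChartedSpace (EuclideanSpace ℝ (Fin m)) G] [IsManifold (𝓡 m) ∞ G]
    [T2Space G] [SecondCountableTopology G]
    [TopologicalSpace M] [ChartedSpace (EuclideanSpace ℝ (Fin n)) M] [IsManifold (𝓡 n) ∞ M]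
    [T2Space M] [SecondCountableTopology M] {𝒢 : Gpd G M}

/-- If the arrows with target in `B` form a manifold `Q` that submerges onto `B` and onto
the saturation `U` of `B`, then multiplication makes `Q` a principal bibundle between
the restrictions of `𝒢` to `B` and to `U`. -/
theorem IsLieGroupoid.nonempty_principalBibundle (h𝒢 : IsLieGroupoid m n 𝒢) {p k l m' n' : ℕ}
    {A V Q : G → Prop} {B U : M → Prop}
    (hA : ∀ g, A g ↔ B (𝒢.src g) ∧ B (𝒢.tgt g)) (hV : ∀ g, V g ↔ U (𝒢.src g) ∧ U (𝒢.tgt g))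
    (hQ : ∀ g, Q g ↔ B (𝒢.tgt g)) (hU : ∀ y, U y ↔ ∃ g, 𝒢.src g = y ∧ B (𝒢.tgt g))
    [ChartedSpace (EuclideanSpace ℝ (Fin k)) {g // A g}]
    [ChartedSpace (EuclideanSpace ℝ (Fin l)) {y // B y}] [IsManifold (𝓡 l) ∞ {y // B y}]
    [ChartedSpace (EuclideanSpace ℝ (Fin m')) {g // V g}]
    [ChartedSpace (EuclideanSpace ℝ (Fin n')) {y // U y}] [IsManifold (𝓡 n') ∞ {y // U y}]
    [ChartedSpace (EuclideanSpace ℝ (Fin p)) {g // Q g}] [IsManifold (𝓡 p) ∞ {g // Q g}]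
    (hιA : IsSmoothEmbedding (𝓡 k) (𝓡 m) ∞ (Subtype.val : {g // A g} → G))
    (hιB : IsSmoothEmbedding (𝓡 l) (𝓡 n) ∞ (Subtype.val : {y // B y} → M))
    (hιV : IsSmoothEmbedding (𝓡 m') (𝓡 m) ∞ (Subtype.val : {g // V g} → G))
    (hιU : IsSmoothEmbedding (𝓡 n') (𝓡 n) ∞ (Subtype.val : {y // U y} → M))
    (hιQ : IsSmoothEmbedding (𝓡 p) (𝓡 m) ∞ (Subtype.val : {g // Q g} → G))
    (htgt : ∀ g, Q g → ∃ (τ : M → G) (O : Set M), IsOpen O ∧ 𝒢.tgt g ∈ O ∧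
      ContMDiffOn (𝓡 n) (𝓡 m) ∞ τ O ∧ τ (𝒢.tgt g) = g ∧
      ∀ y ∈ O, 𝒢.tgt (τ y) = y ∧ (B y → Q (τ y)))
    (hsrc : ∀ g, Q g → ∃ (τ : M → G) (O : Set M), IsOpen O ∧ 𝒢.src g ∈ O ∧
      ContMDiffOn (𝓡 n) (𝓡 m) ∞ τ O ∧ τ (𝒢.src g) = g ∧
      ∀ y ∈ O, 𝒢.src (τ y) = y ∧ (U y → Q (τ y))) :
    Nonempty (PrincipalBibundle p k l m' n' (𝒢.restrict hA) (𝒢.restrict hV) {g // Q g}) := by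
  have hQU : ∀ q, Q q → U (𝒢.src q) := fun q hq => (hU _).2 ⟨q, rfl, (hQ q).1 hq⟩
  let α : {g // Q g} → {y // B y} := fun q => ⟨𝒢.tgt q, (hQ q).1 q.2⟩
  let β : {g // Q g} → {y // U y} := fun q => ⟨𝒢.src q, hQU q q.2⟩
  have hlQ : ∀ (h : {g // A g}) (q : {g // Q g}), 𝒢.src h = 𝒢.tgt q → Q (𝒢.mul h q) :=
    fun h q c => by rw [hQ, 𝒢.tgt_mul _ _ c]; exact ((hA h).1 h.2).2
  have hrQ : ∀ (q : {g // Q g}) (g : {g // V g}), 𝒢.src q = 𝒢.tgt g → Q (𝒢.mul q g) :=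
    fun q g c => by rw [hQ, 𝒢.tgt_mul _ _ c]; exact (hQ q).1 q.2
  have hdA : ∀ q q' : {g // Q g}, 𝒢.src q = 𝒢.src q' → A (𝒢.mul q (𝒢.inv q')) := fun q q' c => by
    have c' := c.trans (𝒢.tgt_inv q').symm
    rw [hA, 𝒢.tgt_mul _ _ c', 𝒢.src_mul _ _ c', 𝒢.src_inv]
    exact ⟨(hQ q').1 q'.2, (hQ q).1 q.2⟩
  have hdV : ∀ q q' : {g // Q g}, 𝒢.tgt q = 𝒢.tgt q' → V (𝒢.mul (𝒢.inv q) q') := fun q q' c => by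
    have c' := (𝒢.src_inv q).trans c
    rw [hV, 𝒢.tgt_mul _ _ c', 𝒢.src_mul _ _ c', 𝒢.tgt_inv]
    exact ⟨hQU _ q'.2, hQU _ q.2⟩
  let lact : {g // A g} → {g // Q g} → {g // Q g} := fun h q => liftOr (𝒢.mul h q) q
  let ract : {g // Q g} → {g // V g} → {g // Q g} := fun q g => liftOr (𝒢.mul q g) q
  have hl : ∀ (h : {g // A g}) (q : {g // Q g}), 𝒢.src h = 𝒢.tgt q →
      (lact h q : G) = 𝒢.mul h q := fun h q c => coe_liftOr (hlQ h q c) _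
  have hr : ∀ (q : {g // Q g}) (g : {g // V g}), 𝒢.src q = 𝒢.tgt g →
      (ract q g : G) = 𝒢.mul q g := fun q g c => coe_liftOr (hrQ q g c) _
  have hprod : ∀ {X Y : G → Prop} {i j : ℕ} [ChartedSpace (EuclideanSpace ℝ (Fin i)) {g // X g}]
      [ChartedSpace (EuclideanSpace ℝ (Fin j)) {g // Y g}]
      (_ : IsSmoothEmbedding (𝓡 i) (𝓡 m) ∞ (Subtype.val : {g // X g} → G))
      (_ : IsSmoothEmbedding (𝓡 j) (𝓡 m) ∞ (Subtype.val : {g // Y g} → G)),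
      ContMDiffOn ((𝓡 i).prod (𝓡 j)) (𝓡 m) ∞
        (fun z : {g // X g} × {g // Y g} => 𝒢.mul z.1 z.2) {z | 𝒢.src z.1 = 𝒢.tgt z.2} :=
    fun hX hY => h𝒢.mul_smooth.comp (((hX.contMDiff.comp contMDiff_fst).prodMk
      (hY.contMDiff.comp contMDiff_snd)).contMDiffOn) fun _ h => h
  have hdiv₁ : ContMDiffOn ((𝓡 p).prod (𝓡 p)) (𝓡 m) ∞
      (fun z : {g // Q g} × {g // Q g} => 𝒢.mul z.1 (𝒢.inv z.2)) {z | 𝒢.src z.1 = 𝒢.src z.2} :=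
    h𝒢.mul_smooth.comp (((hιQ.contMDiff.comp contMDiff_fst).prodMk
      (h𝒢.inv_smooth.comp (hιQ.contMDiff.comp contMDiff_snd))).contMDiffOn)
      fun z h => h.trans (𝒢.tgt_inv z.2).symm
  have hdiv₂ : ContMDiffOn ((𝓡 p).prod (𝓡 p)) (𝓡 m) ∞
      (fun z : {g // Q g} × {g // Q g} => 𝒢.mul (𝒢.inv z.1) z.2) {z | 𝒢.tgt z.1 = 𝒢.tgt z.2} :=
    h𝒢.mul_smooth.comp (((h𝒢.inv_smooth.comp (hιQ.contMDiff.comp contMDiff_fst)).prodMk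
      (hιQ.contMDiff.comp contMDiff_snd)).contMDiffOn)
      fun z h => (𝒢.src_inv z.1).trans h
  have hcoe : ∀ {X : Type u} {R : X → Prop} {a b : {x // R x}}, a = b → (a : X) = b :=
    fun h => congrArg Subtype.val h
  refine ⟨{
    α := α
    β := β
    lact := lact
    ract := ract
    α_surjective := ?_
    α_submersion := ?_
    β_surjective := ?_
    β_submersion := ?_
    α_lact := ?_
    β_lact := ?_
    one_lact := ?_
    mul_lact := ?_
    β_ract := ?_
    α_ract := ?_
    ract_one := ?_
    ract_mul := ?_
    lact_ract := ?_
    left_principal := ?_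
    right_principal := ?_ }⟩
  · intro y
    refine ⟨⟨𝒢.one y, by rw [hQ, 𝒢.tgt_one]; exact y.2⟩, Subtype.ext (𝒢.tgt_one y)⟩
  · exact isSubmersion_of_exists_section hιQ hιB h𝒢.tgt_smooth (fun _ => rfl)
      fun g => htgt g g.2
  · rintro ⟨y, hy⟩
    obtain ⟨g, rfl, hg⟩ := (hU y).1 hy
    exact ⟨⟨g, (hQ g).2 hg⟩, rfl⟩
  · exact isSubmersion_of_exists_section hιQ hιU h𝒢.src_smooth (fun _ => rfl)
      fun g => hsrc g g.2
  · intro h q c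
    refine Subtype.ext ?_
    change 𝒢.tgt (lact h q : G) = 𝒢.tgt h
    rw [hl h q (hcoe c), 𝒢.tgt_mul _ _ (hcoe c)]
  · intro h q c
    refine Subtype.ext ?_
    change 𝒢.src (lact h q : G) = 𝒢.src q
    rw [hl h q (hcoe c), 𝒢.src_mul _ _ (hcoe c)]
  · intro q
    refine Subtype.ext ((hl _ _ ?_).trans ?_)
    · exact 𝒢.src_one _
    · exact 𝒢.one_mul q
  · intro h h' q c d
    have c' : 𝒢.src h = 𝒢.tgt h' := hcoe c
    have d' : 𝒢.src h' = 𝒢.tgt q := hcoe d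
    refine Subtype.ext ?_
    rw [hl, hl, hl _ _ d', 𝒢.coe_restrict_mul hA c', 𝒢.mul_assoc _ _ _ c' d']
    · rw [hl _ _ d', 𝒢.tgt_mul _ _ d', c']
    · rw [𝒢.coe_restrict_mul hA c', 𝒢.src_mul _ _ c', d']
  · intro q g c
    refine Subtype.ext ?_
    change 𝒢.src (ract q g : G) = 𝒢.src g
    rw [hr q g (hcoe c), 𝒢.src_mul _ _ (hcoe c)]
  · intro q g c
    refine Subtype.ext ?_
    change 𝒢.tgt (ract q g : G) = 𝒢.tgt q
    rw [hr q g (hcoe c), 𝒢.tgt_mul _ _ (hcoe c)]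
  · intro q
    refine Subtype.ext ((hr _ _ ?_).trans ?_)
    · exact (𝒢.tgt_one _).symm
    · exact 𝒢.mul_one q
  · intro q g g' c d
    have c' : 𝒢.src q = 𝒢.tgt g := hcoe c
    have d' : 𝒢.src g = 𝒢.tgt g' := hcoe d
    refine Subtype.ext ?_
    rw [hr, hr, hr _ _ c', 𝒢.coe_restrict_mul hV d', 𝒢.mul_assoc _ _ _ c' d']
    · rw [hr _ _ c', 𝒢.src_mul _ _ c', d']
    · rw [𝒢.coe_restrict_mul hV d', 𝒢.tgt_mul _ _ d', c']
  · intro h q g c d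
    have c' : 𝒢.src h = 𝒢.tgt q := hcoe c
    have d' : 𝒢.src q = 𝒢.tgt g := hcoe d
    refine Subtype.ext ?_
    rw [hl, hr _ _ d', hr, hl _ _ c', 𝒢.mul_assoc _ _ _ c' d']
    · rw [hl _ _ c', 𝒢.src_mul _ _ c', d']
    · rw [hr _ _ d', 𝒢.tgt_mul _ _ d', c']
  · have hs₁ : ∀ z : {g // A g} × {g // Q g}, (𝒢.restrict hA).src z.1 = α z.2 →
        𝒢.src z.1 = 𝒢.tgt z.2 := fun z c => hcoe c
    have hs₂ : ∀ z : {g // Q g} × {g // Q g}, β z.1 = β z.2 → 𝒢.src z.1 = 𝒢.src z.2 :=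
      fun z c => hcoe c
    -- The inverse is division on the right, `(q, q') ↦ (q q'⁻¹, q')`.
    refine ⟨?_, ?_, fun z => (liftOr (𝒢.mul z.1 (𝒢.inv z.2)) ((𝒢.restrict hA).one (α z.2)), z.2),
      ?_, ?_, ?_, ?_⟩
    · intro z c
      refine Subtype.ext ?_
      change 𝒢.src (lact z.1 z.2 : G) = 𝒢.src z.2
      rw [hl _ _ (hcoe c), 𝒢.src_mul _ _ (hcoe c)]
    · exact (contMDiffOn_liftOr hιQ ((hprod hιA hιQ).mono hs₁)
        fun z c => hlQ _ _ (hcoe c)).prodMk contMDiffOn_snd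
    · intro z c
      have c' : 𝒢.src z.1 = 𝒢.src z.2 := hcoe c
      refine Subtype.ext ?_
      change 𝒢.src (liftOr _ _ : {g // A g}).1 = 𝒢.tgt z.2
      rw [coe_liftOr (hdA _ _ c'), 𝒢.src_mul _ _ (c'.trans (𝒢.tgt_inv _).symm), 𝒢.src_inv]
    · exact (contMDiffOn_liftOr hιA (hdiv₁.mono hs₂)
        fun z c => hdA _ _ (hcoe c)).prodMk contMDiffOn_snd
    · intro z c
      have c' : 𝒢.src z.1 = 𝒢.tgt z.2 := hcoe c
      have e : 𝒢.mul (lact z.1 z.2) (𝒢.inv z.2) = z.1 := by rw [hl _ _ c', 𝒢.mul_mul_inv c']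
      refine Prod.ext (Subtype.ext ?_) rfl
      exact (coe_liftOr (by rw [e]; exact z.1.2) _).trans e
    · intro z c
      have c' : 𝒢.src z.1 = 𝒢.src z.2 := hcoe c
      have d := coe_liftOr (hdA _ _ c') ((𝒢.restrict hA).one (α z.2))
      refine Prod.ext (Subtype.ext ((hl _ _ ?_).trans ?_)) rfl
      · rw [d, 𝒢.src_mul _ _ (c'.trans (𝒢.tgt_inv _).symm), 𝒢.src_inv]
      · rw [d, 𝒢.mul_inv_mul c']
  · have hs₁ : ∀ z : {g // Q g} × {g // V g}, β z.1 = (𝒢.restrict hV).tgt z.2 →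
        𝒢.src z.1 = 𝒢.tgt z.2 := fun z c => hcoe c
    have hs₂ : ∀ z : {g // Q g} × {g // Q g}, α z.1 = α z.2 → 𝒢.tgt z.1 = 𝒢.tgt z.2 :=
      fun z c => hcoe c
    -- Here the inverse is division on the left, `(q, q') ↦ (q, q⁻¹ q')`.
    refine ⟨?_, ?_, fun z => (z.1, liftOr (𝒢.mul (𝒢.inv z.1) z.2) ((𝒢.restrict hV).one (β z.1))),
      ?_, ?_, ?_, ?_⟩
    · intro z c
      refine Subtype.ext ?_
      change 𝒢.tgt z.1 = 𝒢.tgt (ract z.1 z.2 : G)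
      rw [hr _ _ (hcoe c), 𝒢.tgt_mul _ _ (hcoe c)]
    · exact contMDiffOn_fst.prodMk (contMDiffOn_liftOr hιQ ((hprod hιQ hιV).mono hs₁)
        fun z c => hrQ _ _ (hcoe c))
    · intro z c
      have c' : 𝒢.tgt z.1 = 𝒢.tgt z.2 := hcoe c
      refine Subtype.ext ?_
      change 𝒢.src z.1 = 𝒢.tgt (liftOr _ _ : {g // V g}).1
      rw [coe_liftOr (hdV _ _ c'), 𝒢.tgt_mul _ _ ((𝒢.src_inv _).trans c'), 𝒢.tgt_inv]
    · exact contMDiffOn_fst.prodMk (contMDiffOn_liftOr hιV (hdiv₂.mono hs₂)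
        fun z c => hdV _ _ (hcoe c))
    · intro z c
      have c' : 𝒢.src z.1 = 𝒢.tgt z.2 := hcoe c
      have e : 𝒢.mul (𝒢.inv z.1) (ract z.1 z.2) = z.2 := by rw [hr _ _ c', 𝒢.inv_mul_mul c']
      refine Prod.ext rfl (Subtype.ext ?_)
      exact (coe_liftOr (by rw [e]; exact z.2.2) _).trans e
    · intro z c
      have c' : 𝒢.tgt z.1 = 𝒢.tgt z.2 := hcoe c
      have d := coe_liftOr (hdV _ _ c') ((𝒢.restrict hV).one (β z.1))
      refine Prod.ext rfl (Subtype.ext ((hr _ _ ?_).trans ?_))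
      · rw [d, 𝒢.tgt_mul _ _ ((𝒢.src_inv _).trans c'), 𝒢.tgt_inv]
      · rw [d, 𝒢.mul_mul_inv_mul c']

end LieGpd

/-! ### Openness of the saturation, and properness -/

namespace LieGpd

universe u v

variable {m n : ℕ} {G : Type v} {M : Type u}
    [TopologicalSpace G] [ChartedSpace (EuclideanSpace ℝ (Fin m)) G] [IsManifold (𝓡 m) ∞ G]
    [T2Space G] [SecondCountableTopology G]
    [TopologicalSpace M] [ChartedSpace (EuclideanSpace ℝ (Fin n)) M] [IsManifold (𝓡 n) ∞ M]
    [T2Space M] [SecondCountableTopology M] {𝒢 : Gpd G M} {S : EmbeddedSubmanifold n M}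

theorem Gpd.mem_saturation {G M : Type*} (𝒢 : Gpd G M) {B : Set M} {y : M} :
    y ∈ 𝒢.saturation B ↔ ∃ g, 𝒢.src g = y ∧ 𝒢.tgt g ∈ B := by
  constructor
  · rintro ⟨z, ⟨g, h1, rfl⟩, h2⟩
    exact ⟨g, h1, h2⟩
  · rintro ⟨g, h1, h2⟩
    exact ⟨_, ⟨g, h1, rfl⟩, h2⟩

namespace IsLieGroupoid

theorem isOpen_saturation (h𝒢 : IsLieGroupoid m n 𝒢)
    (hS : ∀ y : S.carrier, S.tangent y ⊔ 𝒢.orbitTangent m n (y : M) = ⊤) :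
    IsOpen (𝒢.saturation S.carrier) := by
  rw [isOpen_iff_mem_nhds]
  intro y hy
  obtain ⟨g, rfl, hg⟩ := 𝒢.mem_saturation.1 hy
  obtain ⟨τ, O, hO, hgO, -, -, hτO⟩ := h𝒢.exists_section_src hS hg
  filter_upwards [hO.mem_nhds hgO] with y hy
  exact 𝒢.mem_saturation.2 ⟨τ y, hτO y hy⟩

/-- Multiplication is continuous only within the composable pairs; composability of the limits
follows from uniqueness of limits in `M`. -/
theorem tendsto_mul (h𝒢 : IsLieGroupoid m n 𝒢) {ι : Type*} {l : Filter ι} [l.NeBot] {f f' : ι → G}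
    {a b : G} (hf : Tendsto f l (𝓝 a)) (hf' : Tendsto f' l (𝓝 b))
    (h : ∀ i, 𝒢.src (f i) = 𝒢.tgt (f' i)) :
    Tendsto (fun i => 𝒢.mul (f i) (f' i)) l (𝓝 (𝒢.mul a b)) := by
  have hab : 𝒢.src a = 𝒢.tgt b := by
    refine tendsto_nhds_unique ((h𝒢.src_smooth.continuous.tendsto a).comp hf) ?_
    refine ((h𝒢.tgt_smooth.continuous.tendsto b).comp hf').congr fun i => (h i).symm
  have hc : ContinuousWithinAt (fun p : G × G => 𝒢.mul p.1 p.2) 𝒢.composable (a, b) :=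
    h𝒢.mul_smooth.continuousOn (a, b) hab
  exact Tendsto.comp hc (tendsto_nhdsWithin_iff.2
    ⟨hf.prodMk_nhds hf', Eventually.of_forall h⟩)

/-- No closedness of `B` is needed: a limit arrow in `G` has both ends equal to `x`, hence belongs
to the restriction. -/
theorem properAt_restrict (h𝒢 : IsLieGroupoid m n 𝒢) {A : G → Prop} {B : M → Prop}
    (hA : ∀ g, A g ↔ B (𝒢.src g) ∧ B (𝒢.tgt g)) {x : M} (hx : B x) (h : 𝒢.ProperAt x) :
    (𝒢.restrict hA).ProperAt ⟨x, hx⟩ := by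
  intro g hg
  have hg' : Tendsto (fun i => (𝒢.src (g i), 𝒢.tgt (g i))) atTop (𝓝 (x, x)) :=
    ((continuous_subtype_val.prodMap continuous_subtype_val).tendsto
      ((⟨x, hx⟩, ⟨x, hx⟩) : {y // B y} × {y // B y})).comp hg
  obtain ⟨a, φ, hφ, ha⟩ := h (fun i => g i) hg'
  have hst : Tendsto (fun i => (𝒢.src (g (φ i)), 𝒢.tgt (g (φ i)))) atTop
      (𝓝 (𝒢.src a, 𝒢.tgt a)) :=
    ((h𝒢.src_smooth.continuous.prodMk h𝒢.tgt_smooth.continuous).tendsto a).comp ha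
  have he := tendsto_nhds_unique hst (hg'.comp hφ.tendsto_atTop)
  have haA : A a := by
    rw [Prod.mk.injEq] at he
    rw [hA, he.1, he.2]
    exact ⟨hx, hx⟩
  exact ⟨⟨a, haA⟩, φ, hφ, tendsto_subtype_rng.2 ha⟩

/-- Properness at `x` can be tested on the restriction to `B` if arrows near the unit at `x` move
points near `x` continuously into `B`. -/
theorem properAt_of_restrict (h𝒢 : IsLieGroupoid m n 𝒢) {A : G → Prop} {B : M → Prop}
    (hA : ∀ g, A g ↔ B (𝒢.src g) ∧ B (𝒢.tgt g)) {x : M} (hx : B x) {τ : M → G} {O : Set M}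
    (hO : O ∈ 𝓝 x) (hτ : ContinuousAt τ x) (hτx : τ x = 𝒢.one x)
    (hτO : ∀ y ∈ O, 𝒢.src (τ y) = y ∧ B (𝒢.tgt (τ y)))
    (h : (𝒢.restrict hA).ProperAt ⟨x, hx⟩) : 𝒢.ProperAt x := by
  intro g hg
  have hs : Tendsto (fun i => 𝒢.src (g i)) atTop (𝓝 x) := (continuous_fst.tendsto _).comp hg
  have ht : Tendsto (fun i => 𝒢.tgt (g i)) atTop (𝓝 x) := (continuous_snd.tendsto _).comp hg
  -- The first `N` terms are dropped because `τ` is controlled only on `O`.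
  obtain ⟨N, hN⟩ := eventually_atTop.1 ((hs.eventually_mem hO).and (ht.eventually_mem hO))
  have hNs : ∀ i, 𝒢.src (g (i + N)) ∈ O := fun i => (hN (i + N) (by omega)).1
  have hNt : ∀ i, 𝒢.tgt (g (i + N)) ∈ O := fun i => (hN (i + N) (by omega)).2
  let a : ℕ → G := fun i => τ (𝒢.src (g (i + N)))
  let b : ℕ → G := fun i => τ (𝒢.tgt (g (i + N)))
  have ha : ∀ i, 𝒢.src (a i) = 𝒢.src (g (i + N)) := fun i => (hτO _ (hNs i)).1
  have hb : ∀ i, 𝒢.src (b i) = 𝒢.tgt (g (i + N)) := fun i => (hτO _ (hNt i)).1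
  have hshift : Tendsto (fun i : ℕ => i + N) atTop atTop := tendsto_add_atTop_nat N
  have hτa : Tendsto a atTop (𝓝 (τ x)) := Tendsto.comp hτ (hs.comp hshift)
  have hτb : Tendsto b atTop (𝓝 (τ x)) := Tendsto.comp hτ (ht.comp hshift)
  have hc : ∀ i, 𝒢.src (𝒢.mul (b i) (g (i + N))) = 𝒢.tgt (𝒢.inv (a i)) := fun i => by
    rw [𝒢.src_mul _ _ (hb i), 𝒢.tgt_inv, ha]
  have hsk : ∀ i, 𝒢.src (𝒢.mul (𝒢.mul (b i) (g (i + N))) (𝒢.inv (a i))) = 𝒢.tgt (a i) :=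
    fun i => by rw [𝒢.src_mul _ _ (hc i), 𝒢.src_inv]
  have htk : ∀ i, 𝒢.tgt (𝒢.mul (𝒢.mul (b i) (g (i + N))) (𝒢.inv (a i))) = 𝒢.tgt (b i) :=
    fun i => by rw [𝒢.tgt_mul _ _ (hc i), 𝒢.tgt_mul _ _ (hb i)]
  -- The arrow `b g a⁻¹` runs from `tgt a` to `tgt b`, both in `B` and both tending to `tgt (τ x) =
  -- x`.
  let k : ℕ → {g // A g} := fun i => ⟨𝒢.mul (𝒢.mul (b i) (g (i + N))) (𝒢.inv (a i)), by
    rw [hA, hsk, htk]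
    exact ⟨(hτO _ (hNs i)).2, (hτO _ (hNt i)).2⟩⟩
  have htx : 𝒢.tgt (τ x) = x := by rw [hτx, 𝒢.tgt_one]
  have hta : Tendsto (fun i => 𝒢.tgt (a i)) atTop (𝓝 x) := by
    have := (h𝒢.tgt_smooth.continuous.tendsto _).comp hτa
    rwa [htx] at this
  have htb : Tendsto (fun i => 𝒢.tgt (b i)) atTop (𝓝 x) := by
    have := (h𝒢.tgt_smooth.continuous.tendsto _).comp hτb
    rwa [htx] at this
  obtain ⟨c, φ, hφ, hlim⟩ := h k (by
    refine Tendsto.prodMk_nhds (tendsto_subtype_rng.2 ?_) (tendsto_subtype_rng.2 ?_)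
    · exact hta.congr fun i => (hsk i).symm
    · exact htb.congr fun i => (htk i).symm)
  have hlim' : Tendsto (fun i => (k (φ i) : G)) atTop (𝓝 c) := tendsto_subtype_rng.1 hlim
  have hφt := hφ.tendsto_atTop
  have h1 : ∀ i, 𝒢.src (𝒢.inv (b (φ i))) = 𝒢.tgt (k (φ i) : G) := fun i => by
    rw [𝒢.src_inv]; exact (htk _).symm
  -- The original arrows are recovered as `b⁻¹ k a`, a product of convergent factors along the
  -- subsequence.
  have hfin := h𝒢.tendsto_mul (h𝒢.tendsto_mul
    (((h𝒢.inv_smooth.continuous.tendsto _).comp hτb).comp hφt) hlim' h1) (hτa.comp hφt)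
    (fun i => (𝒢.src_mul _ _ (h1 i)).trans (hsk _))
  refine ⟨_, fun i => φ i + N, fun i j hij => Nat.add_lt_add_right (hφ hij) N,
    hfin.congr fun i => ?_⟩
  simp only [Function.comp_apply]
  change 𝒢.mul (𝒢.mul (𝒢.inv (b (φ i))) (𝒢.mul (𝒢.mul (b (φ i)) (g (φ i + N)))
    (𝒢.inv (a (φ i))))) (a (φ i)) = _
  rw [𝒢.mul_assoc _ _ _ (hb _) (by rw [𝒢.tgt_inv, ha]), 𝒢.inv_mul_mul, 𝒢.mul_inv_mul (ha _).symm]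
  rw [𝒢.tgt_mul _ _ (by rw [𝒢.tgt_inv, ha]), hb]

end IsLieGroupoid

end LieGpd

/-! ### Assembly -/

theorem mainTheorem10 {m n : ℕ} {G M : Type*}
    [TopologicalSpace G] [ChartedSpace (EuclideanSpace ℝ (Fin m)) G] [IsManifold (𝓡 m) ∞ G]
    [T2Space G] [SecondCountableTopology G]
    [TopologicalSpace M] [ChartedSpace (EuclideanSpace ℝ (Fin n)) M] [IsManifold (𝓡 n) ∞ M]
    [T2Space M] [SecondCountableTopology M]
    (𝒢 : LieGpd.Gpd G M) (h𝒢 : LieGpd.IsLieGroupoid m n 𝒢)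
    (S : LieGpd.EmbeddedSubmanifold n M) (x : M) (hS : LieGpd.IsSlice m n 𝒢 S x) :
    ∃ (A : LieGpd.EmbeddedSubmanifold m G)
      (hA : ∀ g, g ∈ A.carrier ↔ 𝒢.src g ∈ S.carrier ∧ 𝒢.tgt g ∈ S.carrier),
      LieGpd.IsLieGroupoid A.dim S.dim (𝒢.restrict hA : LieGpd.Gpd A.carrier S.carrier) ∧
      (𝒢.restrict hA).IsFixedPoint ⟨x, hS.mem⟩ ∧
      (∃ (U : Opens M) (V : Opens G) (hV : ∀ g, g ∈ V ↔ 𝒢.src g ∈ U ∧ 𝒢.tgt g ∈ U),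
        (U : Set M) = 𝒢.saturation S.carrier ∧
        LieGpd.MoritaEquivalent A.dim S.dim m n
          (𝒢.restrict hA : LieGpd.Gpd A.carrier S.carrier) (𝒢.restrict hV : LieGpd.Gpd V U)) ∧
      (𝒢.ProperAt x ↔ (𝒢.restrict hA).ProperAt ⟨x, hS.mem⟩) := by
  have htr := hS.transversal
  have hne : S.carrier.Nonempty := ⟨x, hS.mem⟩
  obtain ⟨A, hA⟩ := h𝒢.exists_embeddedSubmanifold_restrict htr hne
  obtain ⟨P, hP⟩ := h𝒢.exists_embeddedSubmanifold_preimage_tgt hne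
  let U : Opens M := ⟨𝒢.saturation S.carrier, h𝒢.isOpen_saturation htr⟩
  let V : Opens G := ⟨{g | 𝒢.src g ∈ U ∧ 𝒢.tgt g ∈ U},
    (U.isOpen.preimage h𝒢.src_smooth.continuous).inter
      (U.isOpen.preimage h𝒢.tgt_smooth.continuous)⟩
  have hV : ∀ g, g ∈ V ↔ 𝒢.src g ∈ U ∧ 𝒢.tgt g ∈ U := fun g => Iff.rfl
  have hιU : IsSmoothEmbedding (𝓡 n) (𝓡 n) ∞ (Subtype.val : U → M) :=
    IsSmoothEmbedding.of_opens U
  have hιV : IsSmoothEmbedding (𝓡 m) (𝓡 m) ∞ (Subtype.val : V → G) :=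
    IsSmoothEmbedding.of_opens V
  have hLA : LieGpd.IsLieGroupoid A.dim S.dim
      (𝒢.restrict hA : LieGpd.Gpd A.carrier S.carrier) := by
    refine h𝒢.restrict hA A.isSmoothEmbedding S.isSmoothEmbedding fun g hg => ?_
    obtain ⟨τ, O, hO, hgO, hτ, hτg, hτO⟩ := h𝒢.exists_section_src htr ((hA g).1 hg).2
    -- Targets lie in `S` by the choice of `τ`; over points of `S` the sources do too, so `τ` takes
    -- values in `A` there.
    exact ⟨τ, O, hO, hgO, hτ, hτg, fun y hy => ⟨(hτO y hy).1, fun h =>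
      (hA _).2 ⟨by rw [(hτO y hy).1]; exact h, (hτO y hy).2⟩⟩⟩
  have hLV : LieGpd.IsLieGroupoid m n (𝒢.restrict hV : LieGpd.Gpd V U) := by
    refine h𝒢.restrict hV hιV hιU fun g hg => ?_
    obtain ⟨τ, O, hO, hgO, hτ, hτg, hτO⟩ := h𝒢.src_smooth.exists_local_section
      (h𝒢.mfderiv_src_surjective g) V.isOpen hg
    exact ⟨τ, O, hO, hgO, hτ, hτg, fun y hy => ⟨(hτO y hy).1, fun _ => (hτO y hy).2⟩⟩
  refine ⟨A, hA, hLA, ?_, ⟨U, V, hV, rfl, hLA, hLV, P.dim, P.carrier, inferInstance, inferInstance,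
    inferInstance, inferInstance, inferInstance, ?_⟩, ?_, ?_⟩
  · ext y
    constructor
    · rintro ⟨g, hg, rfl⟩
      have h1 : 𝒢.tgt g.1 ∈ S.carrier ∩ 𝒢.orbit x :=
        ⟨((hA g.1).1 g.2).2, g.1, congrArg Subtype.val hg, rfl⟩
      rw [hS.inter_orbit] at h1
      exact Subtype.ext h1
    · rintro rfl
      exact ⟨(𝒢.restrict hA).one ⟨x, hS.mem⟩, (𝒢.restrict hA).src_one _,
        (𝒢.restrict hA).tgt_one _⟩
  · refine h𝒢.nonempty_principalBibundle hA hV hP (fun y => 𝒢.mem_saturation) A.isSmoothEmbedding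
      S.isSmoothEmbedding hιV hιU P.isSmoothEmbedding (fun g _ => ?_) fun g hg => ?_
    · obtain ⟨τ, O, hO, hgO, hτ, hτg, hτO⟩ := h𝒢.tgt_smooth.exists_local_section
        (h𝒢.mfderiv_tgt_surjective g) isOpen_univ (mem_univ g)
      exact ⟨τ, O, hO, hgO, hτ, hτg, fun y hy => ⟨(hτO y hy).1, fun h =>
        (hP _).2 (by rw [(hτO y hy).1]; exact h)⟩⟩
    · obtain ⟨τ, O, hO, hgO, hτ, hτg, hτO⟩ := h𝒢.exists_section_src htr ((hP g).1 hg)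
      exact ⟨τ, O, hO, hgO, hτ, hτg, fun y hy => ⟨(hτO y hy).1, fun _ => (hP _).2 (hτO y hy).2⟩⟩
  · exact h𝒢.properAt_restrict hA hS.mem
  · obtain ⟨τ, O, hO, hgO, hτ, hτg, hτO⟩ := h𝒢.exists_section_src htr (g := 𝒢.one x)
      (by rw [𝒢.tgt_one]; exact hS.mem)
    rw [𝒢.src_one] at hgO hτg
    exact h𝒢.properAt_of_restrict hA hS.mem (hO.mem_nhds hgO)
      (hτ.continuousOn.continuousAt (hO.mem_nhds hgO)) hτg hτO
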